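/- Let $2\le k\le n$, and let $\mathbb K$ be $\mathbb R$ or $\mathbb C$. Representations are finite-dimensional over $\mathbb K$. For an $n\times n$ matrix $A=(a_{ij})$ put $\Delta_A=\sum_{i<j}a_{ij}(\mathrm{id}-(i\,j))\in\mathbb K[S_n]$, and let $\mathrm{str}_{n,k}$ be the adjacency matrix of the graph on $\{1,\dots,n\}$ in which $k$ is joined to each of $1,\dots,k-1$ and there are no other edges, so that $\Delta_{\mathrm{str}_{n,k}}=\sum_{i<k}(\mathrm{id}-(i\,k))$. For a Young diagram $\alpha$ with $n$ boxes, numbered row by row, let $[\alpha]=\mathbb K[S_n]c_\alpha$ with $S_n$ acting by left multiplication, where $c_\alpha=a_\alpha b_\alpha$, $a_\alpha$ is the sum of all permutations preserving the rows of $\alpha$, and $b_\alpha$ is the sum of $\mathrm{sign}(v)\,v$ over all permutations $v$ preserving the columns of $\alpha$. For $i\le n$ regard $S_i$ as the group of permutations in $S_n$ fixing $i+1,\dots,n$. A Gelfand--Tsetlin basis of a representation $\sigma$ of $S_n$ is defined inductively: for $n=1$, when $\sigma$ is one-dimensional, it consists of one nonzero vector; for $n>1$ one decomposes $\sigma|_{S_{n-1}}$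 into a direct sum $\bigoplus_jV_j$ of irreducible representations of $S_{n-1}$ and takes the union of Gelfand--Tsetlin bases of the $V_j$. Each element $v$ of such a basis thus lies in a summand $V^{(i)}(v)$, a representation of $S_i$, for each $1\le i\le n$, with $V^{(n)}(v)=\sigma$. The element $v$ corresponds to a sequence $\alpha_n,\alpha_{n-1},\dots,\alpha_1$ of Young diagrams, where $\alpha_i$ has $i$ boxes, if $V^{(i)}(v)\cong[\alpha_i]$ as representations of $S_i$ for all $1\le i\le n$. 1. Let $\sigma$ be an irreducible representation of $S_n$. Then $\sigma$ has a Gelfand--Tsetlin basis, and every Gelfand--Tsetlin basis of $\sigma$ is a basis of the underlying vector space consisting of eigenvectors of $\sigma(\Delta_{\mathrm{str}_{n,k}})$. 2. Let $\alpha_n,\alpha_{n-1},\dots,\alpha_1$ be Young diagrams, $\alpha_i$ having $i$ boxes, such that for $2\le i\le n$ the diagram $\alpha_{i-1}$ is obtained from $\alpha_i$ by removing the $x_i$-th box of the $y_i$-th row (both counted from $1$), and let $\sigma\cong[\alpha_n]$. Then every Gelfand--Tsetlin basis of $\sigma$ contains exactly one element $v$ corresponding to this sequence, and $v$ is an eigenvector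 of $\sigma(\Delta_{\mathrm{str}_{n,k}})$ with eigenvalue $(k-1)+y_k-x_k$. -/

import Mathlib

open Equiv
open scoped MonoidAlgebra

noncomputable section

namespace StarGT

/-! ### Laplacians in the group algebra and star graphs -/

/-- For a weight matrix `A`, the element `∑_{i<j} A i j (id - (i j))` of the group algebra. -/
def laplacian {𝕜 : Type*} [Field 𝕜] {n : ℕ} (A : Matrix (Fin n) (Fin n) 𝕜) :
    𝕜[Perm (Fin n)] :=
  ∑ i : Fin n, ∑ j : Fin n with i < j,
    A i j • (MonoidAlgebra.single 1 1 - MonoidAlgebra.single (swap i j) 1)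

/-- The graph on `n` vertices in which the first `k` vertices form a clique and the remaining
vertices are isolated. The vertex called `i` in `{1, …, n}` is the element `i - 1` of `Fin n`. -/
def quasiComplete (n k : ℕ) : SimpleGraph (Fin n) where
  Adj i j := i ≠ j ∧ (i : ℕ) < k ∧ (j : ℕ) < k
  symm := ⟨fun _ _ h => ⟨h.1.symm, h.2.2, h.2.1⟩⟩
  loopless := ⟨fun _ h => h.1 rfl⟩

instance (n k : ℕ) : DecidableRel (quasiComplete n k).Adj :=
  fun i j => inferInstanceAs (Decidable (i ≠ j ∧ (i : ℕ) < k ∧ (j : ℕ) < k))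

/-- The adjacency matrix of the star graph on `{1, …, n}` joining `k` to `1, …, k - 1`, as a
difference of adjacency matrices. -/
def starMatrix (𝕜 : Type*) [Field 𝕜] (n k : ℕ) : Matrix (Fin n) (Fin n) 𝕜 :=
  (quasiComplete n k).adjMatrix 𝕜 - (quasiComplete n (k - 1)).adjMatrix 𝕜

/-! ### The irreducible representation attached to a Young diagram -/

/-- Young diagrams with `n` boxes. -/
abbrev Diagram (n : ℕ) : Type := {μ : YoungDiagram // μ.card = n}

/-- The box `(row, column)` (counted from `0`) containing the number `p` when the boxes of `α` are
numbered row by row, from top to bottom and from left to right in each row. -/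
def Diagram.box {n : ℕ} (α : Diagram n) (p : Fin n) : ℕ × ℕ :=
  ofLex (((α.1.cells.map toLex.toEmbedding).orderEmbOfFin
    ((Finset.card_map _).trans α.2)) p)

/-- The sum of all permutations preserving the rows of `α`. -/
def Diagram.rowSum (𝕜 : Type*) [Field 𝕜] {n : ℕ} (α : Diagram n) : 𝕜[Perm (Fin n)] :=
  ∑ h : Perm (Fin n) with ∀ p, (α.box (h p)).1 = (α.box p).1, MonoidAlgebra.single h 1

/-- The signed sum of all permutations preserving the columns of `α`. -/
def Diagram.colSum (𝕜 : Type*) [Field 𝕜] {n : ℕ} (α : Diagram n) : 𝕜[Perm (Fin n)] :=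
  ∑ v : Perm (Fin n) with ∀ p, (α.box (v p)).2 = (α.box p).2,
    MonoidAlgebra.single v (((Perm.sign v : ℤˣ) : ℤ) : 𝕜)

/-- The Young symmetrizer of `α`. -/
def Diagram.symmetrizer (𝕜 : Type*) [Field 𝕜] {n : ℕ} (α : Diagram n) : 𝕜[Perm (Fin n)] :=
  α.rowSum 𝕜 * α.colSum 𝕜

/-- The left ideal generated by the Young symmetrizer `c`, that is `{r * c | r}`, as a
subrepresentation of the left regular representation. -/
def Diagram.leftIdeal (𝕜 : Type*) [Field 𝕜] {n : ℕ} (α : Diagram n) :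
    Subrepresentation (Representation.leftRegular 𝕜 (Perm (Fin n))) where
  toSubmodule := LinearMap.range (LinearMap.mulRight 𝕜 (α.symmetrizer 𝕜))
  apply_mem_toSubmodule := by
    rintro g _ ⟨r, rfl⟩
    refine ⟨MonoidAlgebra.single g 1 * r, ?_⟩
    have key : ∀ x : 𝕜[Perm (Fin n)],
        Representation.leftRegular 𝕜 (Perm (Fin n)) g x = MonoidAlgebra.single g 1 * x := by
      intro x
      induction x using MonoidAlgebra.induction_linear with
      | zero => simp
      | add x y hx hy => rw [map_add, hx, hy, mul_add]
      | single h a => simp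
    rw [key]
    simp [mul_assoc]

/-- The representation `[α]` of the symmetric group. -/
def Diagram.rep (𝕜 : Type*) [Field 𝕜] {n : ℕ} (α : Diagram n) :
    Representation 𝕜 (Perm (Fin n)) (α.leftIdeal 𝕜).toSubmodule :=
  (α.leftIdeal 𝕜).toRepresentation

/-- `β` is obtained from `α` by removing the `x`-th box of the `y`-th row, both counted
from `1`. -/
def RemovesBox {m n : ℕ} (α : Diagram m) (β : Diagram n) (x y : ℕ) : Prop :=
  1 ≤ x ∧ 1 ≤ y ∧ (y - 1, x - 1) ∈ α.1 ∧ β.1.cells = α.1.cells.erase (y - 1, x - 1)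

/-! ### Gelfand–Tsetlin bases -/

variable {𝕜 V : Type*} [Field 𝕜] [AddCommGroup V] [Module 𝕜 V]

/-- Restriction of a representation of `S_n` to `S_i`, embedded as the permutations of
`{1, …, n}` that fix `i + 1, …, n`. -/
def restrictTo {n : ℕ} (σ : Representation 𝕜 (Perm (Fin n)) V) (i : ℕ) (hi : i ≤ n) :
    Representation 𝕜 (Perm (Fin i)) V :=
  σ.comp (Perm.viaEmbeddingHom (Fin.castLEEmb hi))

/-- `IsGTBasisOf σ U i hi W B`: the set `B` is a Gelfand–Tsetlin basis of the `S_i`-subspace `W` of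
`σ`. For `i = 1` it consists of one nonzero vector. For larger `i` one decomposes the restriction
of `W` to `S_{i-1}` as a direct sum of irreducible representations and takes the union of
Gelfand–Tsetlin bases of the summands. The function `U` records the decompositions:
for `v ∈ B`, `U v i = W`, and `U v j`, for `j < i`, is the summand containing `v`
in the decomposition into irreducible representations of `S_j`. -/
inductive IsGTBasisOf {n : ℕ} (σ : Representation 𝕜 (Perm (Fin n)) V)
    (U : V → ℕ → Submodule 𝕜 V) :
    (i : ℕ) → (hi : i ≤ n) → Subrepresentation (restrictTo σ i hi) → Set V → Prop
  | base (hi : 1 ≤ n) (W : Subrepresentation (restrictTo σ 1 hi)) (v : V)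
      (hv : v ≠ 0) (hW : W.toSubmodule = Submodule.span 𝕜 {v}) (hU : U v 1 = W.toSubmodule) :
      IsGTBasisOf σ U 1 hi W {v}
  | step (i : ℕ) (one_le : 1 ≤ i) (hi : i + 1 ≤ n) (W : Subrepresentation (restrictTo σ (i + 1) hi))
      (m : ℕ) (X : Fin m → Subrepresentation (restrictTo σ i (Nat.le_of_succ_le hi)))
      (C : Fin m → Set V)
      (irreducible : ∀ j, (X j).toRepresentation.IsIrreducible)
      (independent : iSupIndep fun j => (X j).toSubmodule)
      (sum_eq : ⨆ j, (X j).toSubmodule = W.toSubmodule)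
      (basis : ∀ j, IsGTBasisOf σ U i (Nat.le_of_succ_le hi) (X j) (C j))
      (hU : ∀ v ∈ ⋃ j, C j, U v (i + 1) = W.toSubmodule) :
      IsGTBasisOf σ U (i + 1) hi W (⋃ j, C j)

/-- `B` is a Gelfand–Tsetlin basis of `σ`, with summands recorded by `U`. -/
def IsGTBasis {n : ℕ} (σ : Representation 𝕜 (Perm (Fin n)) V)
    (U : V → ℕ → Submodule 𝕜 V) (B : Set V) : Prop :=
  IsGTBasisOf σ U n le_rfl ⊤ B

/-- The element `v` of a Gelfand–Tsetlin basis with summands recorded by `U` corresponds to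
`α n, …, α 1`: for each `i` the irreducible `S_i`-summand containing `v` is isomorphic to
`[α i]`. -/
def Corresponds {n : ℕ} (σ : Representation 𝕜 (Perm (Fin n)) V)
    (U : V → ℕ → Submodule 𝕜 V) (v : V) (α : (i : ℕ) → Diagram i) : Prop :=
  ∀ (i : ℕ) (hi : i ≤ n), 1 ≤ i →
    ∃ W : Subrepresentation (restrictTo σ i hi), W.toSubmodule = U v i ∧
      Nonempty (W.toRepresentation.Equiv ((α i).rep 𝕜))

end StarGT

end

/-! Write k = m + 1, and let T_i be the sum of (p q) over all ordered pairs p, q ≤ i, diagonal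
included (`swapSum`). Passing from T_m to T_{m+1} adds every (p k), p < k, twice and the identity
once, so 2Δ = (2m + 1) - (T_{m+1} - T_m) (`two_smul_laplacian_starMatrix`). Each T_i is central in
the group algebra of S_i. A Gelfand–Tsetlin vector lies in irreducible summands for both S_{m+1} and
S_m, so it is an eigenvector as soon as T_i acts on irreducibles by scalars. Over ℝ Schur's lemma
alone does not give this; instead, multiplication by T_i is a Hermitian matrix in the group basis,
so T_i is annihilated by a polynomial that splits (`exists_splits_aeval_swapSum`).

On [α] the scalar is computed from the tableau, by evaluating a·(p q)·b for the row sum a and signed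
column sum b: this is ab, -ab or 0 for p ≠ q according as p, q share a row, a column or neither
(`rowSum_mul_swap_mul_colSum`). Adding the x-th box of row y raises the scalar by 2(x - y) + 1
(`RemovesBox.content_eq`), which yields the eigenvalue m + y - x.

Existence and uniqueness of the vector attached to a chain of diagrams rest on multiplicity-one
branching (`RemovesBox.existsUnique_equiv`). An irreducible X is isomorphic to [β] exactly when c_β
does not kill X, so the question is the size of c_β K[S_{n+1}] c_α. It is nonzero when a box is
removed (`exists_algMap_mul_ne_zero`). It is at most a line by Gelfand's trick: every permutation is
conjugate to its inverse under S_n, so the centralizer of S_n in K[S_{n+1}] is commutative, hence so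
is c_β K[S_{n+1}] c_β, and this forces dimension at most one (`IsPrimitiveElement.exists_smul_eq`).
-/

namespace StarGT

/-! ### Primitive elements and Gelfand's trick in group algebras -/

section GroupAlgebra

/-- The coordinate basis of a group algebra. -/
noncomputable def groupBasis (𝕜 G : Type*) [Field 𝕜] : Module.Basis G 𝕜 (𝕜[G]) :=
  .ofRepr (MonoidAlgebra.coeffLinearEquiv 𝕜)

theorem groupBasis_apply {𝕜 G : Type*} [Field 𝕜] (g : G) :
    groupBasis 𝕜 G g = MonoidAlgebra.single g 1 := by
  simp [groupBasis]

theorem groupBasis_repr {𝕜 G : Type*} [Field 𝕜] (x : 𝕜[G]) (g : G) :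
    (groupBasis 𝕜 G).repr x g = x.coeff g := rfl

variable {𝕜 G H : Type*} [Field 𝕜] [Group G] [Group H]

theorem coeff_one_mul_comm (x y : 𝕜[G]) : (x * y).coeff 1 = (y * x).coeff 1 := by
  induction x using MonoidAlgebra.induction_linear with
  | zero => simp
  | add x x' hx hx' => simp [add_mul, mul_add, hx, hx']
  | single g a => simp [MonoidAlgebra.coeff_single_mul_apply, MonoidAlgebra.coeff_mul_single_apply,
      mul_comm]

theorem coeff_one_single_mul (x : 𝕜[G]) (g : G) :
    (MonoidAlgebra.single g⁻¹ 1 * x).coeff 1 = x.coeff g := by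
  simp [MonoidAlgebra.coeff_single_mul_apply]

theorem single_inv_mul_single (g : G) :
    (MonoidAlgebra.single g⁻¹ 1 * MonoidAlgebra.single g 1 : 𝕜[G]) = 1 := by
  simp [MonoidAlgebra.single_mul_single, MonoidAlgebra.one_def]

theorem single_mul_single_inv (g : G) :
    (MonoidAlgebra.single g 1 * MonoidAlgebra.single g⁻¹ 1 : 𝕜[G]) = 1 := by
  simp [MonoidAlgebra.single_mul_single, MonoidAlgebra.one_def]

/-- Left multiplication by `x` has trace |G| times the coefficient at 1, and it is nilpotent. This
trace argument is the source of all the nonvanishing statements for primitive elements. -/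
theorem coeff_one_eq_zero_of_mul_self [Fintype G] [CharZero 𝕜] {x : 𝕜[G]} (hx : x * x = 0) :
    x.coeff 1 = 0 := by
  classical
  have h1 : IsNilpotent (LinearMap.mulLeft 𝕜 x) := by
    refine ⟨2, ?_⟩
    rw [LinearMap.pow_mulLeft, pow_two, hx, LinearMap.mulLeft_zero_eq_zero]
  have h2 := (LinearMap.isNilpotent_trace_of_isNilpotent h1).eq_zero
  rw [LinearMap.trace_eq_matrix_trace 𝕜 (groupBasis 𝕜 G), Matrix.trace] at h2
  simp only [Matrix.diag_apply, LinearMap.toMatrix_apply, groupBasis_apply, groupBasis_repr,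
    LinearMap.mulLeft_apply, MonoidAlgebra.coeff_mul_single_apply] at h2
  simpa using h2

/-- A multiple of a primitive idempotent of a group algebra, normalised by a nonzero
coefficient at the identity. -/
structure IsPrimitiveElement (c : 𝕜[G]) : Prop where
  coeff_one : c.coeff 1 ≠ 0
  mul_mul : ∀ x, ∃ s : 𝕜, c * x * c = s • c

namespace IsPrimitiveElement

variable {c : 𝕜[G]}

theorem ne_zero (hc : IsPrimitiveElement c) : c ≠ 0 := by
  rintro rfl
  exact hc.coeff_one (by simp)

variable [Fintype G] [CharZero 𝕜]

theorem exists_mul_self (hc : IsPrimitiveElement c) : ∃ κ : 𝕜, κ ≠ 0 ∧ c * c = κ • c := by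
  obtain ⟨κ, hκ⟩ := hc.mul_mul 1
  rw [mul_one] at hκ
  refine ⟨κ, ?_, hκ⟩
  rintro rfl
  exact hc.coeff_one (coeff_one_eq_zero_of_mul_self (by simpa using hκ))

/-- Minimality of the left ideal generated by `c`. If c y u vanished for all y, then each translate
g⁻¹u would have square zero, so every coefficient of `u` would vanish. -/
theorem exists_mul_eq (hc : IsPrimitiveElement c) {u : 𝕜[G]} (hu : u ≠ 0)
    (huc : ∃ x, u = x * c) : ∃ y : 𝕜[G], ∃ s : 𝕜, s • (c * y) * u = c := by
  obtain ⟨x, rfl⟩ := huc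
  have h : ∃ y, c * y * (x * c) ≠ 0 := by
    by_contra! h
    apply hu
    ext g
    rw [← coeff_one_single_mul]
    apply coeff_one_eq_zero_of_mul_self
    have := h (MonoidAlgebra.single g⁻¹ 1)
    calc _ = MonoidAlgebra.single g⁻¹ 1 * x *
          (c * MonoidAlgebra.single g⁻¹ 1 * (x * c)) := by simp only [mul_assoc]
      _ = 0 := by rw [this, mul_zero]
  obtain ⟨y, hy⟩ := h
  obtain ⟨s, hs⟩ := hc.mul_mul (y * x)
  have hs' : c * y * (x * c) = s • c := by rw [← hs]; simp only [mul_assoc]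
  refine ⟨y, s⁻¹, ?_⟩
  have : s ≠ 0 := by
    rintro rfl
    exact hy (by simpa using hs')
  rw [smul_mul_assoc, hs', smul_smul, inv_mul_cancel₀ this, one_smul]

end IsPrimitiveElement

/-- The anti-involution of a group algebra that inverts the elements of the group. -/
noncomputable def inversion : 𝕜[G] →ₗ[𝕜] 𝕜[G] :=
  (groupBasis 𝕜 G).constr 𝕜 fun g => MonoidAlgebra.single g⁻¹ 1

theorem inversion_single (g : G) (a : 𝕜) :
    inversion (MonoidAlgebra.single g a) = MonoidAlgebra.single g⁻¹ a := by
  have h : (MonoidAlgebra.single g a : 𝕜[G]) = a • groupBasis 𝕜 G g := by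
    simp [groupBasis_apply]
  rw [h, map_smul, inversion, Module.Basis.constr_basis]
  simp

theorem inversion_mul (x y : 𝕜[G]) : inversion (x * y) = inversion y * inversion x := by
  induction x using MonoidAlgebra.induction_linear with
  | zero => simp
  | add x x' hx hx' => simp [add_mul, mul_add, hx, hx']
  | single g a =>
    induction y using MonoidAlgebra.induction_linear with
    | zero => simp
    | add y y' hy hy' => simp [add_mul, mul_add, hy, hy']
    | single h b =>
      simp [inversion_single, MonoidAlgebra.single_mul_single, mul_comm]

theorem coeff_inversion (x : 𝕜[G]) (g : G) : (inversion x).coeff g = x.coeff g⁻¹ := by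
  classical
  induction x using MonoidAlgebra.induction_linear with
  | zero => simp
  | add x x' hx hx' => simp [hx, hx']
  | single h a => simp [inversion_single, Finsupp.single_apply, inv_eq_iff_eq_inv]

/-- Every element of `G` is conjugate to its inverse by an element of the image of `φ`. -/
def ConjInverse (φ : H →* G) : Prop := ∀ g : G, ∃ h : H, φ h * g * (φ h)⁻¹ = g⁻¹

/-- The coefficients of `z` are constant on orbits of conjugation by the image of `φ`, and g and g⁻¹
share an orbit. -/
theorem inversion_eq_self {φ : H →* G} (hφ : ConjInverse φ) {z : 𝕜[G]}
    (hz : ∀ h, MonoidAlgebra.single (φ h) 1 * z = z * MonoidAlgebra.single (φ h) 1) :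
    inversion z = z := by
  ext g
  rw [coeff_inversion]
  obtain ⟨h, hh⟩ := hφ g
  have := congrArg (fun x => x.coeff (φ h * g)) (hz h)
  simp only [MonoidAlgebra.coeff_single_mul_apply, MonoidAlgebra.coeff_mul_single_apply] at this
  rw [hh] at this
  simpa using this.symm

/-- Gelfand's trick: the centralizer is closed under products and fixed pointwise by an
anti-involution, hence commutative. -/
theorem commute_of_conjInverse {φ : H →* G} (hφ : ConjInverse φ) {z z' : 𝕜[G]}
    (hz : ∀ h, MonoidAlgebra.single (φ h) 1 * z = z * MonoidAlgebra.single (φ h) 1)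
    (hz' : ∀ h, MonoidAlgebra.single (φ h) 1 * z' = z' * MonoidAlgebra.single (φ h) 1) :
    z * z' = z' * z := by
  have h : inversion (z * z') = z * z' := by
    apply inversion_eq_self hφ
    intro h
    rw [← mul_assoc, hz, mul_assoc, hz', mul_assoc]
  rw [← h, inversion_mul, inversion_eq_self hφ hz, inversion_eq_self hφ hz']

theorem mul_comm_of_forall_single {z : 𝕜[G]}
    (hz : ∀ g, MonoidAlgebra.single g 1 * z = z * MonoidAlgebra.single g 1) (x : 𝕜[G]) :
    x * z = z * x := by
  induction x using MonoidAlgebra.induction_linear with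
  | zero => simp
  | add x y hx hy => rw [add_mul, mul_add, hx, hy]
  | single g a =>
    have : (MonoidAlgebra.single g a : 𝕜[G]) = a • MonoidAlgebra.single g 1 := by simp
    rw [this, smul_mul_assoc, hz, mul_smul_comm]

/-- The sum of the conjugates of `x` by the elements of the image of `φ`. -/
noncomputable def conjSum [Fintype H] (φ : H →* G) (x : 𝕜[G]) : 𝕜[G] :=
  ∑ h, MonoidAlgebra.single (φ h) 1 * x * MonoidAlgebra.single (φ h)⁻¹ 1

theorem single_mul_conjSum [Fintype H] (φ : H →* G) (x : 𝕜[G]) (h : H) :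
    MonoidAlgebra.single (φ h) 1 * conjSum φ x = conjSum φ x * MonoidAlgebra.single (φ h) 1 := by
  rw [conjSum, Finset.mul_sum, Finset.sum_mul]
  refine Fintype.sum_equiv (Equiv.mulLeft h) _ _ fun g => ?_
  simp only [Equiv.coe_mulLeft, map_mul, mul_inv_rev]
  have h1 : (MonoidAlgebra.single (φ h * φ g) 1 : 𝕜[G]) =
      MonoidAlgebra.single (φ h) 1 * MonoidAlgebra.single (φ g) 1 := by
    simp [MonoidAlgebra.single_mul_single]
  have h2 : (MonoidAlgebra.single ((φ g)⁻¹ * (φ h)⁻¹) 1 : 𝕜[G]) =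
      MonoidAlgebra.single (φ g)⁻¹ 1 * MonoidAlgebra.single (φ h)⁻¹ 1 := by
    simp [MonoidAlgebra.single_mul_single]
  rw [h1, h2]
  simp only [mul_assoc, single_inv_mul_single, mul_one]

/-- The algebra homomorphism between group algebras induced by a group homomorphism. -/
noncomputable abbrev algMap (φ : H →* G) : 𝕜[H] →ₐ[𝕜] 𝕜[G] :=
  MonoidAlgebra.mapDomainAlgHom 𝕜 𝕜 φ

theorem algMap_single (φ : H →* G) (h : H) (a : 𝕜) :
    algMap φ (MonoidAlgebra.single h a) = MonoidAlgebra.single (φ h) a := by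
  simp

theorem algMap_mul_comm {φ : H →* G} {z : 𝕜[G]}
    (hz : ∀ h, MonoidAlgebra.single (φ h) 1 * z = z * MonoidAlgebra.single (φ h) 1) (x : 𝕜[H]) :
    algMap φ x * z = z * algMap φ x := by
  induction x using MonoidAlgebra.induction_linear with
  | zero => simp
  | add x y hx hy => rw [map_add, add_mul, mul_add, hx, hy]
  | single g a =>
    have : (MonoidAlgebra.single g a : 𝕜[H]) = a • MonoidAlgebra.single g 1 := by simp
    rw [this, map_smul, smul_mul_assoc, algMap_single, hz, mul_smul_comm]

section

variable [Fintype H] [CharZero 𝕜] {c : 𝕜[H]}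

/-- The sum is the scalar in cCc, where C, the sum of all conjugates of `c`, is central. Were it
zero, then Cc = 0 and so C² = 0, contradicting that C has coefficient |H| · `c.coeff 1` at 1. -/
theorem IsPrimitiveElement.sum_ne_zero (hc : IsPrimitiveElement c) {f : H → 𝕜}
    (hf : ∀ h, c * MonoidAlgebra.single h 1 * c = f h • c) : ∑ h, f h * f h⁻¹ ≠ 0 := by
  obtain ⟨κ, hκ, hcc⟩ := hc.exists_mul_self
  intro h0
  set C : 𝕜[H] := conjSum (MonoidHom.id H) c with hC
  have hcomm := single_mul_conjSum (MonoidHom.id H) c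
  simp only [MonoidHom.id_apply, ← hC] at hcomm
  have h1 : c * C * c = 0 := by
    rw [hC, conjSum, Finset.mul_sum, Finset.sum_mul]
    have : ∀ h : H, c * (MonoidAlgebra.single h 1 * c * MonoidAlgebra.single h⁻¹ 1) * c =
        (f h * f h⁻¹) • c := by
      intro h
      rw [← mul_assoc, ← mul_assoc, hf, smul_mul_assoc, smul_mul_assoc, hf, smul_smul]
    simp only [MonoidHom.id_apply, this, ← Finset.sum_smul, h0, zero_smul]
  have h2 : C * c = 0 := by
    rw [mul_comm_of_forall_single hcomm, mul_assoc, hcc, mul_smul_comm] at h1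
    exact (smul_eq_zero.mp h1).resolve_left hκ
  have h3 : C * C = 0 := by
    suffices C * conjSum (MonoidHom.id H) c = 0 from this
    rw [conjSum, Finset.mul_sum]
    refine Finset.sum_eq_zero fun h _ => ?_
    simp only [MonoidHom.id_apply]
    rw [← mul_assoc, ← mul_assoc, ← hcomm, mul_assoc (MonoidAlgebra.single h 1), h2]
    simp
  have h4 := coeff_one_eq_zero_of_mul_self h3
  rw [hC, conjSum, MonoidAlgebra.coeff_sum, Finset.sum_apply'] at h4
  have : ∀ h : H, (MonoidAlgebra.single h 1 * c * MonoidAlgebra.single h⁻¹ 1).coeff 1 =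
      c.coeff 1 := by
    intro h
    rw [coeff_one_mul_comm, ← mul_assoc, single_inv_mul_single, one_mul]
  simp [this, hc.coeff_one] at h4

/-- With e the image of `c`, averaging e x e over `H` gives z in the centralizer with ze a nonzero
multiple of e x e. Commutativity thus descends from the centralizer to the corner e k[G] e. -/
theorem IsPrimitiveElement.mul_mul_comm (hc : IsPrimitiveElement c) {φ : H →* G}
    (hφ : ConjInverse φ) (x y : 𝕜[G]) :
    (algMap φ c * x * algMap φ c) * (algMap φ c * y * algMap φ c) =
      (algMap φ c * y * algMap φ c) * (algMap φ c * x * algMap φ c) := by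
  obtain ⟨κ, hκ, hcc⟩ := hc.exists_mul_self
  choose f hf using fun h => hc.mul_mul (MonoidAlgebra.single h 1)
  have hs := hc.sum_ne_zero hf
  set e : 𝕜[G] := algMap φ c with he
  have hee : e * e = κ • e := by rw [he, ← map_mul, hcc, map_smul]
  have hfe : ∀ h, e * MonoidAlgebra.single (φ h) 1 * e = f h • e := by
    intro h
    rw [← algMap_single, he, ← map_mul, ← map_mul, hf, map_smul]
  set l := κ⁻¹ * ∑ h, f h * f h⁻¹ with hl
  have hl0 : l ≠ 0 := mul_ne_zero (inv_ne_zero hκ) hs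
  have key : ∀ x, conjSum φ (e * x * e) * e = l • (e * x * e) := by
    intro x
    have hz := single_mul_conjSum φ (e * x * e)
    have hze := algMap_mul_comm hz c
    rw [← he] at hze
    have h1 : e * conjSum φ (e * x * e) * e = (∑ h, f h * f h⁻¹) • (e * x * e) := by
      rw [conjSum, Finset.mul_sum, Finset.sum_mul, Finset.sum_smul]
      refine Finset.sum_congr rfl fun h _ => ?_
      calc e * (MonoidAlgebra.single (φ h) 1 * (e * x * e) * MonoidAlgebra.single (φ h)⁻¹ 1) * e
          = (e * MonoidAlgebra.single (φ h) 1 * e) * x *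
            (e * MonoidAlgebra.single (φ h⁻¹) 1 * e) := by simp only [mul_assoc, map_inv]
        _ = (f h * f h⁻¹) • (e * x * e) := by
          rw [hfe, hfe]
          simp only [smul_mul_assoc, mul_smul_comm, smul_smul, mul_comm]
    rw [hze, mul_assoc, hee, mul_smul_comm] at h1
    rw [hl, mul_smul, ← h1, smul_smul, inv_mul_cancel₀ hκ, one_smul]
  have hprod : ∀ x y, (l * l) • ((e * x * e) * (e * y * e)) =
      conjSum φ (e * x * e) * conjSum φ (e * y * e) * (e * e) := by
    intro x y
    have hze := algMap_mul_comm (single_mul_conjSum φ (e * y * e)) c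
    rw [← he] at hze
    rw [mul_smul, ← mul_smul_comm, ← key y, ← smul_mul_assoc, ← key x, mul_assoc, ← mul_assoc e,
      hze]
    simp only [mul_assoc]
  have h := hprod x y
  rw [commute_of_conjInverse hφ (single_mul_conjSum φ _) (single_mul_conjSum φ _), ← hprod y x] at h
  exact smul_right_injective _ (mul_ne_zero hl0 hl0) h

/-- Multiplicity one: `c k[G] d` is at most one-dimensional. -/
theorem IsPrimitiveElement.exists_smul_eq [Fintype G] (hc : IsPrimitiveElement c) {d : 𝕜[G]}
    (hd : IsPrimitiveElement d) {φ : H →* G} (hφ : ConjInverse φ) {u v : 𝕜[G]} (hu : u ≠ 0)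
    (hu' : ∃ x, u = algMap φ c * x * d) (hv' : ∃ x, v = algMap φ c * x * d) :
    ∃ s : 𝕜, v = s • u := by
  obtain ⟨κ, hκ, hcc⟩ := hc.exists_mul_self
  obtain ⟨κ', hκ', hdd⟩ := hd.exists_mul_self
  obtain ⟨u₀, hu₀⟩ := hu'
  obtain ⟨v₀, hv₀⟩ := hv'
  obtain ⟨y, s, hw⟩ := hd.exists_mul_eq hu ⟨_, hu₀⟩
  -- With w u = d, the corner elements P = e u₀ d w e and Q = e v₀ w e send u to multiples of u and
  -- v, while P sends v into the line of u. Comparing PQu with QPu puts v on that line.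
  obtain ⟨r, hr⟩ := hd.mul_mul (y * (algMap φ c * v₀))
  have hcomm := hc.mul_mul_comm hφ (u₀ * d * (s • (d * y))) (v₀ * (s • (d * y)))
  set e : 𝕜[G] := algMap φ c with he
  have hee : e * e = κ • e := by rw [he, ← map_mul, hcc, map_smul]
  obtain ⟨w, hw'⟩ : ∃ w, w = s • (d * y) := ⟨_, rfl⟩
  rw [← hw'] at hw hcomm
  have heu : e * u = κ • u := by
    rw [hu₀, ← mul_assoc, ← mul_assoc, hee]; simp only [smul_mul_assoc]
  have hev : e * v = κ • v := by
    rw [hv₀, ← mul_assoc, ← mul_assoc, hee]; simp only [smul_mul_assoc]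
  have hud : u * d = κ' • u := by rw [hu₀, mul_assoc, hdd, mul_smul_comm]
  have hwv : w * v = (s * r) • d := by
    rw [hw', hv₀, mul_smul, ← hr, smul_mul_assoc]; simp only [mul_assoc]
  have hP : ∀ x, e * (u₀ * d * w) * e * x = u * (w * (e * x)) := by
    intro x; rw [hu₀]; simp only [mul_assoc]
  have hQ : e * (v₀ * w) * e * u = κ • v := by
    calc _ = e * v₀ * (w * (e * u)) := by simp only [mul_assoc]
      _ = _ := by rw [heu, mul_smul_comm, hw, mul_smul_comm, ← hv₀]
  have h : e * (u₀ * d * w) * e * (e * (v₀ * w) * e * u) =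
      e * (v₀ * w) * e * (e * (u₀ * d * w) * e * u) := by
    rw [← mul_assoc, hcomm, mul_assoc]
  have hPu : e * (u₀ * d * w) * e * u = (κ * κ') • u := by
    simp only [hP, heu, mul_smul_comm, hw, hud, smul_smul]
  have hPv : e * (u₀ * d * w) * e * v = (κ * (s * r) * κ') • u := by
    simp only [hP, hev, mul_smul_comm, hwv, hud, smul_smul]
  rw [hQ, hPu, mul_smul_comm, mul_smul_comm, hPv, hQ, smul_smul, smul_smul] at h
  refine ⟨s * r, ?_⟩
  have h' : (κ * κ * κ') • v = (κ * κ * κ') • ((s * r) • u) := by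
    rw [smul_smul]
    convert h.symm using 2 <;> ring
  exact smul_right_injective _ (mul_ne_zero (mul_ne_zero hκ hκ) hκ') h'

end

end GroupAlgebra

/-! ### Reflecting the cycles of a permutation -/

/-- A permutation is conjugate to its inverse by a permutation fixing a given point. -/
theorem exists_conj_eq_inv {ι : Type*} (g : Perm ι) (a : ι) :
    ∃ t : Perm ι, t a = a ∧ t * g * t⁻¹ = g⁻¹ := by
  classical
  let S : Setoid ι := Perm.SameCycle.setoid g
  -- A base point in each cycle, chosen to be `a` in the cycle of `a`. Reflecting each cycle about
  -- its base point, g^i r ↦ g^(-i) r, inverts `g` and fixes `a`.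
  let r : ι → ι := fun x => if g.SameCycle a x then a else (Quotient.mk S x).out
  have hr : ∀ x, g.SameCycle (r x) x := by
    intro x
    by_cases h : g.SameCycle a x
    · simp [r, h]
    · simp only [r, h, if_false]
      exact Quotient.mk_out (s := S) x
  have hrr : ∀ x y, g.SameCycle x y → r x = r y := by
    intro x y h
    have h2 : g.SameCycle a x ↔ g.SameCycle a y := ⟨fun h' => h'.trans h, fun h' => h'.trans h.symm⟩
    have h3 : Quotient.mk S x = Quotient.mk S y := Quotient.sound h
    simp only [r, h2, h3]
  choose e he using hr
  -- The reflection does not depend on the exponent used to reach a point, even on finite cycles.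
  have key : ∀ x (i : ℤ), (g ^ i) (r x) = x → (g ^ (-i)) (r x) = (g ^ (-e x)) (r x) := by
    intro x i hi
    have h : (g ^ i) (r x) = (g ^ e x) (r x) := by rw [hi, he]
    have h1 := congrArg (g ^ (-i + -e x)) h
    rw [← Perm.mul_apply, ← Perm.mul_apply, ← zpow_add, ← zpow_add] at h1
    simpa using h1.symm
  let f : ι → ι := fun x => (g ^ (-e x)) (r x)
  have hf : ∀ x (i : ℤ), r x = r ((g ^ i) (r x)) → f ((g ^ i) (r x)) = (g ^ (-i)) (r x) := by
    intro x i h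
    have := key ((g ^ i) (r x)) i (by rw [← h])
    rw [← h] at this
    rw [this]
    simp only [f, ← h]
  have hr1 : ∀ x (i : ℤ), r x = r ((g ^ i) (r x)) := by
    intro x i
    apply hrr
    have h1 : g.SameCycle x (r x) := Perm.SameCycle.symm ⟨e x, he x⟩
    exact h1.trans ⟨i, rfl⟩
  have hff : Function.Involutive f := by
    intro x
    change f ((g ^ (-e x)) (r x)) = x
    rw [hf x _ (hr1 x _), neg_neg, he]
  refine ⟨hff.toPerm, ?_, ?_⟩
  · have hra : r a = a := if_pos (Perm.SameCycle.refl g a)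
    have := hf a 0 (hr1 a 0)
    simpa [hra] using this
  · rw [mul_inv_eq_iff_eq_mul]
    ext x
    have h1 : g x = (g ^ (1 + e x)) (r x) := by
      rw [zpow_add, Perm.mul_apply, he, zpow_one]
    have h2 : f (g x) = (g ^ (-(1 + e x))) (r x) := by rw [h1, hf x _ (hr1 x _)]
    simp only [Perm.mul_apply, Function.Involutive.coe_toPerm]
    rw [h2, neg_add, zpow_add, Perm.mul_apply, zpow_neg_one]

theorem conjInverse_viaEmbeddingHom (n : ℕ) :
    ConjInverse (Perm.viaEmbeddingHom (Fin.castLEEmb (Nat.le_succ n))) := by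
  intro g
  obtain ⟨t, ht, htg⟩ := exists_conj_eq_inv g (Fin.last n)
  have hval : ∀ p : Fin n, ((t p.castSucc : Fin (n + 1)) : ℕ) < n := by
    intro p
    by_contra h
    have h1 : t p.castSucc = Fin.last n := Fin.ext (by simp; omega)
    rw [← ht] at h1
    exact (Fin.castSucc_lt_last p).ne (t.injective h1)
  have hinj : Function.Injective fun p : Fin n => (⟨t p.castSucc, hval p⟩ : Fin n) := by
    intro p q h
    have h1 : t p.castSucc = t q.castSucc := Fin.ext (Fin.mk.inj_iff.mp h)
    exact Fin.castSucc_injective n (t.injective h1)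
  refine ⟨Equiv.ofBijective _ (Finite.injective_iff_bijective.mp hinj), ?_⟩
  suffices h : Perm.viaEmbeddingHom (Fin.castLEEmb (Nat.le_succ n))
      (Equiv.ofBijective _ (Finite.injective_iff_bijective.mp hinj)) = t by rw [h]; exact htg
  refine Equiv.ext fun p => ?_
  refine Fin.lastCases ?_ (fun q => ?_) p
  · rw [ht, Perm.viaEmbeddingHom_apply, Perm.viaEmbedding_apply_of_notMem]
    rintro ⟨x, hx⟩
    exact (Fin.castSucc_lt_last x).ne hx
  · rw [Perm.viaEmbeddingHom_apply]
    exact Perm.viaEmbedding_apply _ (Fin.castLEEmb (Nat.le_succ n)) q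

/-! ### Tableaux -/

/-- A numbering `t` of the boxes of `μ` by the elements of `Fin n`. -/
structure IsTableau {n : ℕ} (μ : YoungDiagram) (t : Fin n → ℕ × ℕ) : Prop where
  injective : Function.Injective t
  mem_iff : ∀ c, c ∈ μ ↔ ∃ p, t p = c

theorem Diagram.isTableau_box {n : ℕ} (α : Diagram n) : IsTableau α.1 α.box := by
  constructor
  · intro p q h
    exact (RelEmbedding.injective _) (ofLex.injective h)
  · intro c
    have h := Finset.range_orderEmbOfFin (α.1.cells.map toLex.toEmbedding)
      ((Finset.card_map _).trans α.2)
    have h2 : toLex c ∈ Set.range ((α.1.cells.map toLex.toEmbedding).orderEmbOfFin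
      ((Finset.card_map _).trans α.2)) ↔ c ∈ α.1 := by
      rw [h]; simp
    rw [← h2]
    rfl

section

variable {n : ℕ} (t : Fin n → ℕ × ℕ)

/-- The permutation `h` preserves the rows of `t`. -/
def RowPres (h : Perm (Fin n)) : Prop := ∀ p, (t (h p)).1 = (t p).1

/-- The permutation `h` preserves the columns of `t`. -/
def ColPres (h : Perm (Fin n)) : Prop := ∀ p, (t (h p)).2 = (t p).2

/-- The sum of all permutations preserving the rows of `t`. -/
noncomputable def rowSum (𝕜 : Type*) [Field 𝕜] : 𝕜[Perm (Fin n)] :=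
  ∑ h : Perm (Fin n) with ∀ p, (t (h p)).1 = (t p).1, MonoidAlgebra.single h 1

/-- The signed sum of all permutations preserving the columns of `t`. -/
noncomputable def colSum (𝕜 : Type*) [Field 𝕜] : 𝕜[Perm (Fin n)] :=
  ∑ v : Perm (Fin n) with ∀ p, (t (v p)).2 = (t p).2,
    MonoidAlgebra.single v (((Perm.sign v : ℤˣ) : ℤ) : 𝕜)

variable {t}

theorem RowPres.mul {g h : Perm (Fin n)} (hg : RowPres t g) (hh : RowPres t h) :
    RowPres t (g * h) := fun p => by rw [Perm.mul_apply, hg, hh]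

theorem RowPres.inv {g : Perm (Fin n)} (hg : RowPres t g) : RowPres t g⁻¹ := fun p => by
  have := hg (g⁻¹ p)
  simpa using this.symm

theorem ColPres.mul {g h : Perm (Fin n)} (hg : ColPres t g) (hh : ColPres t h) :
    ColPres t (g * h) := fun p => by rw [Perm.mul_apply, hg, hh]

theorem ColPres.inv {g : Perm (Fin n)} (hg : ColPres t g) : ColPres t g⁻¹ := fun p => by
  have := hg (g⁻¹ p)
  simpa using this.symm

theorem rowPres_swap {p q : Fin n} (h : (t p).1 = (t q).1) : RowPres t (swap p q) := by
  intro r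
  by_cases h1 : r = p
  · subst h1; simp [h]
  by_cases h2 : r = q
  · subst h2; simp [h]
  rw [swap_apply_of_ne_of_ne h1 h2]

theorem colPres_swap {p q : Fin n} (h : (t p).2 = (t q).2) : ColPres t (swap p q) := by
  intro r
  by_cases h1 : r = p
  · subst h1; simp [h]
  by_cases h2 : r = q
  · subst h2; simp [h]
  rw [swap_apply_of_ne_of_ne h1 h2]

variable {𝕜 : Type*} [Field 𝕜]

theorem single_mul_rowSum {h : Perm (Fin n)} (hh : RowPres t h) :
    MonoidAlgebra.single h 1 * rowSum t 𝕜 = rowSum t 𝕜 := by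
  rw [rowSum, Finset.mul_sum]
  refine Finset.sum_bij' (fun g _ => h * g) (fun g _ => h⁻¹ * g) ?_ ?_ ?_ ?_ ?_
  · intro g hg
    exact Finset.mem_filter.mpr ⟨Finset.mem_univ _,
      hh.mul (show RowPres t g from (Finset.mem_filter.mp hg).2)⟩
  · intro g hg
    exact Finset.mem_filter.mpr ⟨Finset.mem_univ _,
      hh.inv.mul (show RowPres t g from (Finset.mem_filter.mp hg).2)⟩
  all_goals simp [MonoidAlgebra.single_mul_single]

theorem rowSum_mul_single {h : Perm (Fin n)} (hh : RowPres t h) :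
    rowSum t 𝕜 * MonoidAlgebra.single h 1 = rowSum t 𝕜 := by
  rw [rowSum, Finset.sum_mul]
  refine Finset.sum_bij' (fun g _ => g * h) (fun g _ => g * h⁻¹) ?_ ?_ ?_ ?_ ?_
  · intro g hg
    exact Finset.mem_filter.mpr ⟨Finset.mem_univ _,
      RowPres.mul (show RowPres t g from (Finset.mem_filter.mp hg).2) hh⟩
  · intro g hg
    exact Finset.mem_filter.mpr ⟨Finset.mem_univ _,
      RowPres.mul (show RowPres t g from (Finset.mem_filter.mp hg).2) hh.inv⟩
  all_goals simp [MonoidAlgebra.single_mul_single]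

/-- The sign of a permutation as an element of a field. -/
def signIn (𝕜 : Type*) [Field 𝕜] (v : Perm (Fin n)) : 𝕜 := (((Perm.sign v : ℤˣ) : ℤ) : 𝕜)

theorem signIn_mul (g h : Perm (Fin n)) : signIn 𝕜 (g * h) = signIn 𝕜 g * signIn 𝕜 h := by
  simp [signIn]

theorem signIn_inv (g : Perm (Fin n)) : signIn 𝕜 g⁻¹ = signIn 𝕜 g := by
  simp [signIn]

theorem signIn_mul_self (g : Perm (Fin n)) : signIn 𝕜 g * signIn 𝕜 g = 1 := by
  rw [← signIn_mul]
  simp [signIn]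

theorem single_mul_colSum {h : Perm (Fin n)} (hh : ColPres t h) :
    MonoidAlgebra.single h 1 * colSum t 𝕜 = signIn 𝕜 h • colSum t 𝕜 := by
  rw [colSum, Finset.mul_sum, Finset.smul_sum]
  refine Finset.sum_bij' (fun g _ => h * g) (fun g _ => h⁻¹ * g) ?_ ?_ ?_ ?_ ?_
  · intro g hg
    exact Finset.mem_filter.mpr ⟨Finset.mem_univ _,
      hh.mul (show ColPres t g from (Finset.mem_filter.mp hg).2)⟩
  · intro g hg
    exact Finset.mem_filter.mpr ⟨Finset.mem_univ _,
      hh.inv.mul (show ColPres t g from (Finset.mem_filter.mp hg).2)⟩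
  · simp
  · simp
  · intro g _
    have := signIn_mul (𝕜 := 𝕜) h g
    simp only [MonoidAlgebra.single_mul_single, one_mul, MonoidAlgebra.smul_single, smul_eq_mul]
    congr 1
    change signIn 𝕜 g = signIn 𝕜 h * signIn 𝕜 (h * g)
    rw [signIn_mul, ← mul_assoc, signIn_mul_self, one_mul]

theorem colSum_mul_single {h : Perm (Fin n)} (hh : ColPres t h) :
    colSum t 𝕜 * MonoidAlgebra.single h 1 = signIn 𝕜 h • colSum t 𝕜 := by
  rw [colSum, Finset.sum_mul, Finset.smul_sum]
  refine Finset.sum_bij' (fun g _ => g * h) (fun g _ => g * h⁻¹) ?_ ?_ ?_ ?_ ?_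
  · intro g hg
    exact Finset.mem_filter.mpr ⟨Finset.mem_univ _,
      ColPres.mul (show ColPres t g from (Finset.mem_filter.mp hg).2) hh⟩
  · intro g hg
    exact Finset.mem_filter.mpr ⟨Finset.mem_univ _,
      ColPres.mul (show ColPres t g from (Finset.mem_filter.mp hg).2) hh.inv⟩
  · simp
  · simp
  · intro g _
    simp only [MonoidAlgebra.single_mul_single, mul_one, MonoidAlgebra.smul_single, smul_eq_mul]
    congr 1
    change signIn 𝕜 g = signIn 𝕜 h * signIn 𝕜 (g * h)
    rw [signIn_mul, mul_left_comm, signIn_mul_self, mul_one]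

theorem coeff_colSum (g : Perm (Fin n)) [Decidable (ColPres t g)] :
    (colSum t 𝕜).coeff g = if ColPres t g then signIn 𝕜 g else 0 := by
  classical
  rw [colSum, MonoidAlgebra.coeff_sum, Finset.sum_apply']
  simp only [MonoidAlgebra.coeff_single, Finsupp.single_apply, Finset.sum_ite_eq',
    Finset.mem_filter, Finset.mem_univ, true_and]
  exact if_congr Iff.rfl rfl rfl

theorem coeff_one_rowSum_mul_colSum (ht : Function.Injective t) :
    (rowSum t 𝕜 * colSum t 𝕜).coeff 1 = 1 := by
  classical
  rw [rowSum, Finset.sum_mul, MonoidAlgebra.coeff_sum, Finset.sum_apply',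
    Finset.sum_eq_single_of_mem 1]
  · have : ColPres t 1 := fun _ => rfl
    simp [← MonoidAlgebra.one_def, coeff_colSum, this, signIn]
  · simp
  · intro h hh h1
    rw [MonoidAlgebra.coeff_single_mul_apply, mul_one, one_mul, coeff_colSum, if_neg]
    intro hc
    apply h1
    ext1 p
    have h2 := hc (h p)
    simp only [Perm.inv_def, Equiv.symm_apply_apply] at h2
    exact ht (Prod.ext ((Finset.mem_filter.mp hh).2 p) h2.symm)

/-- A permutation `g` such that no two elements of a row of `t` lie in the same column of
the translate of `t` by `g` is the product of a row and a column permutation. -/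
theorem exists_rowPres_mul_colPres {μ : YoungDiagram} (ht : IsTableau μ t) (g : Perm (Fin n))
    (hg : Function.Injective fun p => ((t p).1, (t (g⁻¹ p)).2)) :
    ∃ h v, RowPres t h ∧ ColPres t v ∧ g = h * v := by
  classical
  have key : ∀ p, ((t p).1, (t (g⁻¹ p)).2) ∈ μ := by
    intro p₀
    set j := μ.rowLen (t p₀).1 with hj
    -- Row by row, count the entries whose column is below j before and after translation by `g`. In
    -- a row of length at most j, `B r` is everything; in a longer row it has j elements, which
    -- injectivity makes the maximum for `A r`.
    let A : ℕ → Finset (Fin n) := fun r =>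
      Finset.univ.filter fun p => (t p).1 = r ∧ (t (g⁻¹ p)).2 < j
    let B : ℕ → Finset (Fin n) := fun r => Finset.univ.filter fun p => (t p).1 = r ∧ (t p).2 < j
    have hmem : ∀ p, (t p).2 < μ.rowLen (t p).1 := by
      intro p
      rw [← YoungDiagram.mem_iff_lt_rowLen]
      exact (ht.mem_iff _).mpr ⟨p, rfl⟩
    have hAB : ∀ r, (A r).card ≤ (B r).card := by
      intro r
      rcases le_total (μ.rowLen r) j with hr | hr
      · apply Finset.card_le_card
        intro p hp
        simp only [A, B, Finset.mem_filter, Finset.mem_univ, true_and] at hp ⊢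
        refine ⟨hp.1, ?_⟩
        have := hmem p
        rw [hp.1] at this
        omega
      · have h1 : (A r).card ≤ (Finset.range j).card := by
          refine Finset.card_le_card_of_injOn (fun p => (t (g⁻¹ p)).2) ?_ ?_
          · intro p hp
            have : (t p).1 = r ∧ (t (g⁻¹ p)).2 < j := by simpa [A] using hp
            simpa using this.2
          · intro p hp q hq h
            have hp' : (t p).1 = r ∧ (t (g⁻¹ p)).2 < j := by simpa [A] using hp
            have hq' : (t q).1 = r ∧ (t (g⁻¹ q)).2 < j := by simpa [A] using hq
            exact hg (Prod.ext (hp'.1.trans hq'.1.symm) h)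
        have h2 : (Finset.range j).card ≤ (B r).card := by
          have h3 : ∀ c : ℕ, ∃ p, c < j → t p = (r, c) := by
            intro c
            by_cases hc : c < j
            · obtain ⟨p, hp⟩ := (ht.mem_iff (r, c)).mp
                (YoungDiagram.mem_iff_lt_rowLen.mpr (by omega))
              exact ⟨p, fun _ => hp⟩
            · exact ⟨p₀, fun h => absurd h hc⟩
          choose f hf using h3
          refine Finset.card_le_card_of_injOn f ?_ ?_
          · intro c hc
            have hc' : c < j := by simpa using hc
            simp [B, hf c hc', hc']
          · intro c hc d hd h
            have := hf c (by simpa using hc)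
            rw [h, hf d (by simpa using hd)] at this
            simpa using this.symm
        omega
    have hsum : ∀ (s : Fin n → Prop) [DecidablePred s], ∑ r ∈ Finset.univ.image (fun p => (t p).1),
        (Finset.univ.filter fun p => (t p).1 = r ∧ s p).card = (Finset.univ.filter s).card := by
      intro s _
      rw [Finset.card_eq_sum_card_fiberwise (f := fun p => (t p).1)
        (t := Finset.univ.image (fun p => (t p).1)) (by intro p _; simp)]
      refine Finset.sum_congr rfl fun r _ => ?_
      congr 1
      ext p
      simp [and_comm]
    have hcard : (Finset.univ.filter fun p => (t (g⁻¹ p)).2 < j).card =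
        (Finset.univ.filter fun p => (t p).2 < j).card := by
      refine Finset.card_bij (fun p _ => g⁻¹ p) (by simp) (by simp) ?_
      intro q hq
      exact ⟨g q, by simpa using hq, by simp⟩
    have hsumeq := (hsum (fun p => (t (g⁻¹ p)).2 < j)).trans
      (hcard.trans (hsum (fun p => (t p).2 < j)).symm)
    -- The totals over all rows agree, so every inequality is an equality. In the row of `p₀`, whose
    -- length is exactly j, all entries therefore satisfy the bound.
    have heq := (Finset.sum_eq_sum_iff_of_le (fun r _ => hAB r)).mp hsumeq (t p₀).1 (by simp)
    have hBrow : B (t p₀).1 = Finset.univ.filter fun p => (t p).1 = (t p₀).1 := by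
      ext p
      simp only [B, Finset.mem_filter, Finset.mem_univ, true_and, and_iff_left_iff_imp]
      intro h
      have := hmem p
      rwa [h] at this
    have hArow : A (t p₀).1 = Finset.univ.filter fun p => (t p).1 = (t p₀).1 := by
      apply Finset.eq_of_subset_of_card_le
      · intro p hp
        simp only [A, Finset.mem_filter, Finset.mem_univ, true_and] at hp ⊢
        exact hp.1
      · rw [heq, hBrow]
    have : p₀ ∈ A (t p₀).1 := by rw [hArow]; simp
    simp only [A, Finset.mem_filter, Finset.mem_univ, true_and] at this
    exact YoungDiagram.mem_iff_lt_rowLen.mpr this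
  choose f hf using fun p => (ht.mem_iff _).mp (key p)
  have hfi : Function.Injective f := by
    intro p q h
    apply hg
    change ((t p).1, (t (g⁻¹ p)).2) = ((t q).1, (t (g⁻¹ q)).2)
    rw [← hf, ← hf, h]
  -- Each entry moves within its row to the column that its preimage under `g` has in `t`, so `h *
  -- g` preserves columns.
  let h := Equiv.ofBijective f (Finite.injective_iff_bijective.mp hfi)
  have hrow : RowPres t h := fun p => by
    change (t (f p)).1 = _
    rw [hf]
  refine ⟨h⁻¹, h * g, hrow.inv, ?_, by simp⟩
  intro p
  change (t (f (g p))).2 = _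
  rw [hf]
  simp

/-- The row sum absorbs (p q); moved past `g` it becomes a column transposition, which the column
sum absorbs with sign -1. The product thus equals its own negative. -/
theorem rowSum_mul_single_mul_colSum_eq_zero [CharZero 𝕜] {g : Perm (Fin n)} {p q : Fin n}
    (hpq : p ≠ q) (hrow : (t p).1 = (t q).1) (hcol : (t (g⁻¹ p)).2 = (t (g⁻¹ q)).2) :
    rowSum t 𝕜 * MonoidAlgebra.single g 1 * colSum t 𝕜 = 0 := by
  have h1 : rowSum t 𝕜 * MonoidAlgebra.single g 1 * colSum t 𝕜 =
      -(rowSum t 𝕜 * MonoidAlgebra.single g 1 * colSum t 𝕜) := by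
    conv_lhs => rw [← rowSum_mul_single (rowPres_swap hrow)]
    have : (MonoidAlgebra.single (swap p q) 1 * MonoidAlgebra.single g 1 : 𝕜[Perm (Fin n)]) =
        MonoidAlgebra.single g 1 * MonoidAlgebra.single (swap (g⁻¹ p) (g⁻¹ q)) 1 := by
      rw [MonoidAlgebra.single_mul_single, MonoidAlgebra.single_mul_single,
        mul_swap_eq_swap_mul]
      simp
    rw [mul_assoc (rowSum t 𝕜), this, mul_assoc, mul_assoc _ _ (colSum t 𝕜),
      single_mul_colSum (colPres_swap hcol)]
    have hne : g⁻¹ p ≠ g⁻¹ q := fun h => hpq (g⁻¹.injective h)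
    rw [signIn, Perm.sign_swap hne]
    simp [mul_assoc]
  have h2 : (2 : 𝕜) • (rowSum t 𝕜 * MonoidAlgebra.single g 1 * colSum t 𝕜) = 0 := by
    rw [two_smul]
    exact add_eq_zero_iff_eq_neg.mpr h1
  exact (smul_eq_zero.mp h2).resolve_left two_ne_zero

/-- Von Neumann's dichotomy: a permutation is either a row permutation times a column permutation,
contributing a sign, or has a pair of entries that makes its term vanish. -/
theorem exists_rowSum_mul_mul_colSum [CharZero 𝕜] {μ : YoungDiagram} (ht : IsTableau μ t)
    (x : 𝕜[Perm (Fin n)]) :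
    ∃ s : 𝕜, rowSum t 𝕜 * x * colSum t 𝕜 = s • (rowSum t 𝕜 * colSum t 𝕜) := by
  induction x using MonoidAlgebra.induction_linear with
  | zero => exact ⟨0, by simp⟩
  | add x y hx hy =>
    obtain ⟨r, hr⟩ := hx
    obtain ⟨s, hs⟩ := hy
    exact ⟨r + s, by rw [mul_add, add_mul, hr, hs, add_smul]⟩
  | single g a =>
    suffices ∃ s : 𝕜, rowSum t 𝕜 * MonoidAlgebra.single g 1 * colSum t 𝕜 =
        s • (rowSum t 𝕜 * colSum t 𝕜) by
      obtain ⟨s, hs⟩ := this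
      have h : (MonoidAlgebra.single g a : 𝕜[Perm (Fin n)]) = a • MonoidAlgebra.single g 1 := by
        simp
      exact ⟨a * s, by rw [h, mul_smul_comm, smul_mul_assoc, hs, smul_smul]⟩
    by_cases hg : Function.Injective fun p => ((t p).1, (t (g⁻¹ p)).2)
    · obtain ⟨h, v, hh, hv, rfl⟩ := exists_rowPres_mul_colPres ht g hg
      have : (MonoidAlgebra.single (h * v) 1 : 𝕜[Perm (Fin n)]) =
          MonoidAlgebra.single h 1 * MonoidAlgebra.single v 1 := by
        simp [MonoidAlgebra.single_mul_single]
      refine ⟨signIn 𝕜 v, ?_⟩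
      rw [this, ← mul_assoc, rowSum_mul_single hh, mul_assoc, single_mul_colSum hv, mul_smul_comm]
    · rw [Function.not_injective_iff] at hg
      obtain ⟨p, q, hpq, hne⟩ := hg
      refine ⟨0, ?_⟩
      rw [zero_smul, rowSum_mul_single_mul_colSum_eq_zero hne (Prod.mk.inj hpq).1
        (Prod.mk.inj hpq).2]

theorem isPrimitiveElement_rowSum_mul_colSum [CharZero 𝕜] {μ : YoungDiagram}
    (ht : IsTableau μ t) : IsPrimitiveElement (rowSum t 𝕜 * colSum t 𝕜) where
  coeff_one := by rw [coeff_one_rowSum_mul_colSum ht.injective]; exact one_ne_zero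
  mul_mul x := by
    obtain ⟨s, hs⟩ := exists_rowSum_mul_mul_colSum ht (colSum t 𝕜 * x * rowSum t 𝕜)
    exact ⟨s, by rw [← hs]; simp only [mul_assoc]⟩

theorem inversion_rowSum : inversion (rowSum t 𝕜) = rowSum t 𝕜 := by
  rw [rowSum, map_sum]
  refine Finset.sum_bij' (fun g _ => g⁻¹) (fun g _ => g⁻¹) ?_ ?_ ?_ ?_ ?_
  · intro g hg
    exact Finset.mem_filter.mpr ⟨Finset.mem_univ _,
      RowPres.inv (show RowPres t g from (Finset.mem_filter.mp hg).2)⟩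
  · intro g hg
    exact Finset.mem_filter.mpr ⟨Finset.mem_univ _,
      RowPres.inv (show RowPres t g from (Finset.mem_filter.mp hg).2)⟩
  all_goals simp [inversion_single]

theorem inversion_colSum : inversion (colSum t 𝕜) = colSum t 𝕜 := by
  rw [colSum, map_sum]
  refine Finset.sum_bij' (fun g _ => g⁻¹) (fun g _ => g⁻¹) ?_ ?_ ?_ ?_ ?_
  · intro g hg
    exact Finset.mem_filter.mpr ⟨Finset.mem_univ _,
      ColPres.inv (show ColPres t g from (Finset.mem_filter.mp hg).2)⟩
  · intro g hg
    exact Finset.mem_filter.mpr ⟨Finset.mem_univ _,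
      ColPres.inv (show ColPres t g from (Finset.mem_filter.mp hg).2)⟩
  all_goals simp [inversion_single]

/-- Inversion fixes both sums and reverses their product. -/
theorem isPrimitiveElement_colSum_mul_rowSum [CharZero 𝕜] {μ : YoungDiagram}
    (ht : IsTableau μ t) : IsPrimitiveElement (colSum t 𝕜 * rowSum t 𝕜) where
  coeff_one := by
    rw [coeff_one_mul_comm, coeff_one_rowSum_mul_colSum ht.injective]
    exact one_ne_zero
  mul_mul x := by
    have h2 : ∀ y : 𝕜[Perm (Fin n)], inversion (inversion y) = y := by
      intro y; ext g; simp [coeff_inversion]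
    obtain ⟨s, hs⟩ := (isPrimitiveElement_rowSum_mul_colSum (𝕜 := 𝕜) ht).mul_mul (inversion x)
    refine ⟨s, ?_⟩
    have := congrArg inversion hs
    simpa [inversion_mul, inversion_rowSum, inversion_colSum, h2, mul_assoc] using this

end

/-! ### The sum of all transpositions -/

/-- The sum of the transpositions `(p q)` over all ordered pairs. -/
noncomputable def swapSum (𝕜 : Type*) [Field 𝕜] (n : ℕ) : 𝕜[Perm (Fin n)] :=
  ∑ p, ∑ q, MonoidAlgebra.single (swap p q) 1

/-- The scalar by which `swapSum` acts on the representation attached to a tableau. -/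
def content (𝕜 : Type*) [Field 𝕜] {n : ℕ} (t : Fin n → ℕ × ℕ) : 𝕜 :=
  ∑ p, ∑ q, ((if (t p).1 = (t q).1 then 1 else 0) - (if (t p).2 = (t q).2 then 1 else 0) +
    if p = q then 1 else 0)

section

variable {𝕜 : Type*} [Field 𝕜] {n : ℕ} {t : Fin n → ℕ × ℕ}

theorem single_mul_swapSum (g : Perm (Fin n)) :
    MonoidAlgebra.single g 1 * swapSum 𝕜 n = swapSum 𝕜 n * MonoidAlgebra.single g 1 := by
  simp only [swapSum, Finset.mul_sum, Finset.sum_mul]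
  refine Fintype.sum_equiv g _ _ fun p => ?_
  refine Fintype.sum_equiv g _ _ fun q => ?_
  rw [MonoidAlgebra.single_mul_single, MonoidAlgebra.single_mul_single, mul_swap_eq_swap_mul]

theorem mul_swapSum (x : 𝕜[Perm (Fin n)]) : x * swapSum 𝕜 n = swapSum 𝕜 n * x :=
  mul_comm_of_forall_single single_mul_swapSum x

theorem rowSum_mul_swap_mul_colSum [CharZero 𝕜] {μ : YoungDiagram} (ht : IsTableau μ t)
    (p q : Fin n) : rowSum t 𝕜 * MonoidAlgebra.single (swap p q) 1 * colSum t 𝕜 =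
      ((if (t p).1 = (t q).1 then 1 else 0) - (if (t p).2 = (t q).2 then 1 else 0) +
        if p = q then 1 else 0 : 𝕜) • (rowSum t 𝕜 * colSum t 𝕜) := by
  by_cases hpq : p = q
  · subst hpq
    simp [Perm.one_def.symm, ← MonoidAlgebra.one_def]
  by_cases hrow : (t p).1 = (t q).1
  · have hcol : (t p).2 ≠ (t q).2 := fun h => hpq (ht.injective (Prod.ext hrow h))
    rw [rowSum_mul_single (rowPres_swap hrow)]
    simp [hrow, hcol, hpq]
  by_cases hcol : (t p).2 = (t q).2
  · rw [mul_assoc, single_mul_colSum (colPres_swap hcol)]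
    simp [hrow, hcol, hpq, signIn, Perm.sign_swap hpq]
  simp only [hrow, hcol, hpq, if_false, sub_zero, add_zero, zero_smul]
  have hp : t p ∈ μ := (ht.mem_iff _).mpr ⟨p, rfl⟩
  have hq : t q ∈ μ := (ht.mem_iff _).mpr ⟨q, rfl⟩
  -- Of the two other corners of the rectangle spanned by the boxes of p and q, at least one is in
  -- the diagram. Its entry r shares a row with one of p, q and a column with the other, so the swap
  -- produces a vanishing pair.
  have h : ((t q).1, (t p).2) ∈ μ ∨ ((t p).1, (t q).2) ∈ μ := by
    rcases lt_or_gt_of_ne hrow with h1 | h1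
    · rcases lt_or_gt_of_ne hcol with h2 | h2
      · exact Or.inl (μ.up_left_mem le_rfl h2.le hq)
      · exact Or.inr (μ.up_left_mem le_rfl h2.le hp)
    · exact Or.inl (μ.up_left_mem h1.le le_rfl hp)
  rcases h with h | h
  · obtain ⟨r, hr⟩ := (ht.mem_iff _).mp h
    have hrq : r ≠ q := by
      rintro rfl
      exact hcol (by rw [hr])
    have hrp : r ≠ p := by
      rintro rfl
      exact hrow (by rw [hr])
    refine rowSum_mul_single_mul_colSum_eq_zero hrq (by rw [hr]) ?_
    rw [swap_inv, swap_apply_right, swap_apply_of_ne_of_ne hrp hrq, hr]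
  · obtain ⟨r, hr⟩ := (ht.mem_iff _).mp h
    have hrq : r ≠ q := by
      rintro rfl
      exact hrow (by rw [hr])
    have hrp : r ≠ p := by
      rintro rfl
      exact hcol (by rw [hr])
    refine rowSum_mul_single_mul_colSum_eq_zero hrp (by rw [hr]) ?_
    rw [swap_inv, swap_apply_left, swap_apply_of_ne_of_ne hrp hrq, hr]

theorem swapSum_mul_rowSum_mul_colSum [CharZero 𝕜] {μ : YoungDiagram} (ht : IsTableau μ t) :
    swapSum 𝕜 n * (rowSum t 𝕜 * colSum t 𝕜) = content 𝕜 t • (rowSum t 𝕜 * colSum t 𝕜) := by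
  rw [← mul_assoc, ← mul_swapSum, swapSum, content]
  simp only [Finset.mul_sum, Finset.sum_mul, Finset.sum_smul, rowSum_mul_swap_mul_colSum ht]

/-! ### Change of tableau -/

theorem IsTableau.exists_comp {μ : YoungDiagram} {t' : Fin n → ℕ × ℕ} (ht : IsTableau μ t)
    (ht' : IsTableau μ t') : ∃ w : Perm (Fin n), t' = t ∘ w := by
  choose f hf using fun p => (ht.mem_iff _).mp ((ht'.mem_iff (t' p)).mpr ⟨p, rfl⟩)
  have hfi : Function.Injective f := by
    intro p q h
    apply ht'.injective
    rw [← hf, ← hf, h]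
  exact ⟨Equiv.ofBijective f (Finite.injective_iff_bijective.mp hfi), funext fun p => (hf p).symm⟩

theorem single_mul_mul_single (w : Perm (Fin n)) (g : Perm (Fin n)) (a : 𝕜) :
    MonoidAlgebra.single w⁻¹ 1 * MonoidAlgebra.single g a * MonoidAlgebra.single w 1 =
      MonoidAlgebra.single (w⁻¹ * g * w) a := by
  simp [MonoidAlgebra.single_mul_single]

theorem rowSum_comp (w : Perm (Fin n)) : rowSum (t ∘ w) 𝕜 =
    MonoidAlgebra.single w⁻¹ 1 * rowSum t 𝕜 * MonoidAlgebra.single w 1 := by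
  simp only [rowSum, Finset.mul_sum, Finset.sum_mul, single_mul_mul_single]
  refine Finset.sum_bij' (fun g _ => w * g * w⁻¹) (fun g _ => w⁻¹ * g * w) ?_ ?_ ?_ ?_ ?_
  · intro g hg
    refine Finset.mem_filter.mpr ⟨Finset.mem_univ _, fun p => ?_⟩
    simpa using (Finset.mem_filter.mp hg).2 (w⁻¹ p)
  · intro g hg
    refine Finset.mem_filter.mpr ⟨Finset.mem_univ _, fun p => ?_⟩
    simpa using (Finset.mem_filter.mp hg).2 (w p)
  all_goals simp [mul_assoc]

theorem colSum_comp (w : Perm (Fin n)) : colSum (t ∘ w) 𝕜 =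
    MonoidAlgebra.single w⁻¹ 1 * colSum t 𝕜 * MonoidAlgebra.single w 1 := by
  simp only [colSum, Finset.mul_sum, Finset.sum_mul, single_mul_mul_single]
  refine Finset.sum_bij' (fun g _ => w * g * w⁻¹) (fun g _ => w⁻¹ * g * w) ?_ ?_ ?_ ?_ ?_
  · intro g hg
    refine Finset.mem_filter.mpr ⟨Finset.mem_univ _, fun p => ?_⟩
    simpa using (Finset.mem_filter.mp hg).2 (w⁻¹ p)
  · intro g hg
    refine Finset.mem_filter.mpr ⟨Finset.mem_univ _, fun p => ?_⟩
    simpa using (Finset.mem_filter.mp hg).2 (w p)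
  · simp [mul_assoc]
  · simp [mul_assoc]
  · intro g _
    have h : signIn 𝕜 (w * g * w⁻¹) = signIn 𝕜 g := by
      rw [signIn_mul, signIn_mul, signIn_inv, mul_right_comm, signIn_mul_self, one_mul]
    have h' : w⁻¹ * (w * g * w⁻¹) * w = g := by group
    rw [h']
    exact congrArg _ h.symm

theorem rowSum_mul_colSum_comp (w : Perm (Fin n)) : rowSum (t ∘ w) 𝕜 * colSum (t ∘ w) 𝕜 =
    MonoidAlgebra.single w⁻¹ 1 * (rowSum t 𝕜 * colSum t 𝕜) * MonoidAlgebra.single w 1 := by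
  rw [rowSum_comp, colSum_comp]
  calc _ = MonoidAlgebra.single w⁻¹ 1 * rowSum t 𝕜 *
        (MonoidAlgebra.single w 1 * MonoidAlgebra.single w⁻¹ 1) *
          colSum t 𝕜 * MonoidAlgebra.single w 1 := by simp only [mul_assoc]
    _ = _ := by rw [single_mul_single_inv]; simp only [mul_assoc, one_mul]

/-! ### Adding a box to a tableau -/

/-- The embedding of `S_n` into `S_{n+1}`. -/
noncomputable abbrev permSucc (n : ℕ) : Perm (Fin n) →* Perm (Fin (n + 1)) :=
  Perm.viaEmbeddingHom (Fin.castLEEmb (Nat.le_succ n))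

theorem permSucc_castSucc (h : Perm (Fin n)) (p : Fin n) :
    permSucc n h p.castSucc = (h p).castSucc := by
  rw [permSucc, Perm.viaEmbeddingHom_apply]
  exact Perm.viaEmbedding_apply _ (Fin.castLEEmb (Nat.le_succ n)) p

theorem permSucc_last (h : Perm (Fin n)) : permSucc n h (Fin.last n) = Fin.last n := by
  rw [permSucc, Perm.viaEmbeddingHom_apply, Perm.viaEmbedding_apply_of_notMem]
  rintro ⟨x, hx⟩
  exact (Fin.castSucc_lt_last x).ne hx

theorem sign_permSucc (h : Perm (Fin n)) : Perm.sign (permSucc n h) = Perm.sign h := by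
  classical
  rw [permSucc, Perm.viaEmbeddingHom_apply, Perm.viaEmbedding, Perm.sign_extendDomain]

variable {c : ℕ × ℕ}

theorem RowPres.permSucc {h : Perm (Fin n)} (hh : RowPres t h) :
    RowPres (Fin.snoc (α := fun _ => ℕ × ℕ) t c) (permSucc n h) := by
  intro p
  refine Fin.lastCases ?_ (fun q => ?_) p
  · rw [permSucc_last]
  · rw [permSucc_castSucc, Fin.snoc_castSucc, Fin.snoc_castSucc, hh]

theorem ColPres.permSucc {h : Perm (Fin n)} (hh : ColPres t h) :
    ColPres (Fin.snoc (α := fun _ => ℕ × ℕ) t c) (permSucc n h) := by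
  intro p
  refine Fin.lastCases ?_ (fun q => ?_) p
  · rw [permSucc_last]
  · rw [permSucc_castSucc, Fin.snoc_castSucc, Fin.snoc_castSucc, hh]

/-- Row permutations of the small tableau are row permutations of the enlarged one; the scalar is
their number. -/
theorem algMap_rowSum_mul [CharZero 𝕜] : ∃ s : 𝕜, s ≠ 0 ∧
    algMap (permSucc n) (rowSum t 𝕜) * rowSum (Fin.snoc (α := fun _ => ℕ × ℕ) t c) 𝕜 =
      s • rowSum (Fin.snoc (α := fun _ => ℕ × ℕ) t c) 𝕜 := by
  refine ⟨((Finset.univ.filter fun h : Perm (Fin n) => ∀ p, (t (h p)).1 = (t p).1).card : 𝕜),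
    Nat.cast_ne_zero.mpr (Finset.card_ne_zero.mpr ⟨1, by simp⟩), ?_⟩
  conv_lhs => rw [rowSum, map_sum, Finset.sum_mul]
  rw [Finset.sum_congr rfl (g := fun _ => rowSum (Fin.snoc (α := fun _ => ℕ × ℕ) t c) 𝕜),
    Finset.sum_const, Nat.cast_smul_eq_nsmul]
  intro h hh
  rw [algMap_single, single_mul_rowSum (RowPres.permSucc (Finset.mem_filter.mp hh).2)]

theorem colSum_mul_algMap [CharZero 𝕜] : ∃ s : 𝕜, s ≠ 0 ∧
    colSum (Fin.snoc (α := fun _ => ℕ × ℕ) t c) 𝕜 * algMap (permSucc n) (colSum t 𝕜) =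
      s • colSum (Fin.snoc (α := fun _ => ℕ × ℕ) t c) 𝕜 := by
  refine ⟨((Finset.univ.filter fun h : Perm (Fin n) => ∀ p, (t (h p)).2 = (t p).2).card : 𝕜),
    Nat.cast_ne_zero.mpr (Finset.card_ne_zero.mpr ⟨1, by simp⟩), ?_⟩
  conv_lhs => rw [colSum.eq_1 t, map_sum, Finset.mul_sum]
  rw [Finset.sum_congr rfl (g := fun _ => colSum (Fin.snoc (α := fun _ => ℕ × ℕ) t c) 𝕜),
    Finset.sum_const, Nat.cast_smul_eq_nsmul]
  intro h hh
  have h1 : (MonoidAlgebra.single (permSucc n h) (((Perm.sign h : ℤˣ) : ℤ) : 𝕜)) =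
      signIn 𝕜 (permSucc n h) • MonoidAlgebra.single (permSucc n h) 1 := by
    simp [signIn, sign_permSucc]
  rw [algMap_single, h1, mul_smul_comm,
    colSum_mul_single (ColPres.permSucc (Finset.mem_filter.mp hh).2), smul_smul, signIn_mul_self,
    one_smul]

/-- With a, b for the small tableau and a', b' for the enlarged one, vanishing would give (ba)² a'b'
= 0. Since (ba)² is a nonzero multiple of ba and a is absorbed by a', this leaves b a'b' = 0. But
its coefficient at 1 is that of a'b'b, a nonzero multiple of a'b', whose coefficient at 1 is 1. -/
theorem exists_algMap_mul_ne_zero [CharZero 𝕜] {μ ν : YoungDiagram} (ht : IsTableau μ t)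
    {t' : Fin (n + 1) → ℕ × ℕ} (ht' : IsTableau ν t')
    (hs : IsTableau ν (Fin.snoc (α := fun _ => ℕ × ℕ) t c)) :
    ∃ r, algMap (permSucc n) (rowSum t 𝕜 * colSum t 𝕜) * r * (rowSum t' 𝕜 * colSum t' 𝕜) ≠ 0 := by
  obtain ⟨w, hw⟩ := ht'.exists_comp hs
  obtain ⟨κ, hκ, hcc⟩ := (isPrimitiveElement_colSum_mul_rowSum (𝕜 := 𝕜) ht).exists_mul_self
  obtain ⟨r₁, hr₁, h₁⟩ := algMap_rowSum_mul (𝕜 := 𝕜) (t := t) (c := c)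
  obtain ⟨r₂, hr₂, h₂⟩ := colSum_mul_algMap (𝕜 := 𝕜) (t := t) (c := c)
  have hcomp := rowSum_mul_colSum_comp (𝕜 := 𝕜) (t := t') w
  rw [← hw] at hcomp
  have hone := coeff_one_rowSum_mul_colSum (𝕜 := 𝕜) hs.injective
  generalize rowSum (Fin.snoc (α := fun _ => ℕ × ℕ) t c) 𝕜 = a' at *
  generalize colSum (Fin.snoc (α := fun _ => ℕ × ℕ) t c) 𝕜 = b' at *
  generalize rowSum t 𝕜 = a at *
  generalize colSum t 𝕜 = b at *
  by_contra! h
  have h3 : algMap (permSucc n) (b * a) * (a' * b') = 0 := by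
    have h4 : algMap (permSucc n) ((b * a) * (b * a)) * (a' * b') = 0 := by
      calc _ = algMap (permSucc n) b * (algMap (permSucc n) (a * b) *
            (algMap (permSucc n) a * MonoidAlgebra.single w⁻¹ 1) * (rowSum t' 𝕜 * colSum t' 𝕜)) *
              MonoidAlgebra.single w 1 := by
            rw [hcomp]; simp only [map_mul, mul_assoc]
        _ = 0 := by rw [h]; simp
    rw [hcc, map_smul, smul_mul_assoc] at h4
    exact (smul_eq_zero.mp h4).resolve_left hκ
  have h5 : algMap (permSucc n) b * (a' * b') = 0 := by
    rw [map_mul, mul_assoc, ← mul_assoc _ a', h₁, smul_mul_assoc, mul_smul_comm] at h3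
    exact (smul_eq_zero.mp h3).resolve_left hr₁
  have h6 := coeff_one_mul_comm (algMap (permSucc n) b) (a' * b')
  rw [h5, mul_assoc, h₂, mul_smul_comm, MonoidAlgebra.coeff_smul_apply, hone] at h6
  simp at h6
  exact hr₂ h6.symm

end

/-! ### Removing a box from a diagram -/

section

variable {n : ℕ} {α : Diagram (n + 1)} {β : Diagram n} {x y : ℕ}

theorem RemovesBox.mem_iff (h : RemovesBox α β x y) (c : ℕ × ℕ) :
    c ∈ β.1 ↔ c ≠ (y - 1, x - 1) ∧ c ∈ α.1 := by
  rw [← YoungDiagram.mem_cells, h.2.2.2, Finset.mem_erase, YoungDiagram.mem_cells]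

theorem RemovesBox.isTableau_snoc (h : RemovesBox α β x y) :
    IsTableau α.1 (Fin.snoc (α := fun _ => ℕ × ℕ) β.box (y - 1, x - 1)) := by
  have hβ := β.isTableau_box
  have hne : ∀ p, β.box p ≠ (y - 1, x - 1) := fun p =>
    ((h.mem_iff _).mp ((hβ.mem_iff _).mpr ⟨p, rfl⟩)).1
  constructor
  · intro p q
    refine Fin.lastCases ?_ (fun p => ?_) p <;> refine Fin.lastCases ?_ (fun q => ?_) q
    · simp
    · simpa using fun h => absurd h.symm (hne q)
    · simpa using fun h => absurd h (hne p)
    · simpa using fun h => hβ.injective h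
  · intro c
    constructor
    · intro hc
      by_cases hc' : c = (y - 1, x - 1)
      · exact ⟨Fin.last n, by simp [hc']⟩
      · obtain ⟨p, hp⟩ := (hβ.mem_iff c).mp ((h.mem_iff c).mpr ⟨hc', hc⟩)
        exact ⟨p.castSucc, by simp [hp]⟩
    · rintro ⟨p, rfl⟩
      refine Fin.lastCases ?_ (fun q => ?_) p
      · simpa using h.2.2.1
      · simpa using ((h.mem_iff _).mp ((hβ.mem_iff _).mpr ⟨q, rfl⟩)).2

theorem RemovesBox.card_row (h : RemovesBox α β x y) :
    (Finset.univ.filter fun p => (β.box p).1 = y - 1).card = x - 1 := by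
  have hβ := β.isTableau_box
  rw [← Finset.card_range (x - 1)]
  refine Finset.card_bij (fun p _ => (β.box p).2) ?_ ?_ ?_
  · intro p hp
    have hp' : (β.box p).1 = y - 1 := by simpa using hp
    rw [Finset.mem_range]
    by_contra hlt
    have h1 : (y - 1, x - 1) ∈ β.1 :=
      β.1.up_left_mem hp'.ge (not_lt.mp hlt) ((hβ.mem_iff _).mpr ⟨p, rfl⟩)
    exact ((h.mem_iff _).mp h1).1 rfl
  · intro p hp q hq hpq
    have hp' : (β.box p).1 = y - 1 := by simpa using hp
    have hq' : (β.box q).1 = y - 1 := by simpa using hq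
    exact hβ.injective (Prod.ext (hp'.trans hq'.symm) hpq)
  · intro j hj
    have hj' : j < x - 1 := by simpa using hj
    obtain ⟨p, hp⟩ := (hβ.mem_iff (y - 1, j)).mp ((h.mem_iff _).mpr
      ⟨by simp; omega, α.1.up_left_mem le_rfl hj'.le h.2.2.1⟩)
    exact ⟨p, by simp [hp], by simp [hp]⟩

theorem RemovesBox.card_col (h : RemovesBox α β x y) :
    (Finset.univ.filter fun p => (β.box p).2 = x - 1).card = y - 1 := by
  have hβ := β.isTableau_box
  rw [← Finset.card_range (y - 1)]
  refine Finset.card_bij (fun p _ => (β.box p).1) ?_ ?_ ?_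
  · intro p hp
    have hp' : (β.box p).2 = x - 1 := by simpa using hp
    rw [Finset.mem_range]
    by_contra hlt
    have h1 : (y - 1, x - 1) ∈ β.1 :=
      β.1.up_left_mem (not_lt.mp hlt) hp'.ge ((hβ.mem_iff _).mpr ⟨p, rfl⟩)
    exact ((h.mem_iff _).mp h1).1 rfl
  · intro p hp q hq hpq
    have hp' : (β.box p).2 = x - 1 := by simpa using hp
    have hq' : (β.box q).2 = x - 1 := by simpa using hq
    exact hβ.injective (Prod.ext hpq (hp'.trans hq'.symm))
  · intro j hj
    have hj' : j < y - 1 := by simpa using hj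
    obtain ⟨p, hp⟩ := (hβ.mem_iff (j, x - 1)).mp ((h.mem_iff _).mpr
      ⟨by simp; omega, α.1.up_left_mem hj'.le le_rfl h.2.2.1⟩)
    exact ⟨p, by simp [hp], by simp [hp]⟩

variable {𝕜 : Type*} [Field 𝕜]

/-- The new box shares its row with x - 1 old boxes and its column with y - 1. Each such pair counts
in both orders, and the new diagonal term gives 1. -/
theorem RemovesBox.content_snoc (h : RemovesBox α β x y) :
    content 𝕜 (Fin.snoc (α := fun _ => ℕ × ℕ) β.box (y - 1, x - 1)) =
      content 𝕜 β.box + 2 * ((x : 𝕜) - y) + 1 := by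
  have hx : ((x - 1 : ℕ) : 𝕜) = x - 1 := by rw [Nat.cast_sub h.1, Nat.cast_one]
  have hy : ((y - 1 : ℕ) : 𝕜) = y - 1 := by rw [Nat.cast_sub h.2.1, Nat.cast_one]
  have h1 : ∀ p : Fin n, Fin.last n ≠ p.castSucc := fun p => (Fin.castSucc_lt_last p).ne'
  have h2 : ∀ p : Fin n, p.castSucc ≠ Fin.last n := fun p => (Fin.castSucc_lt_last p).ne
  have h3 : ∑ p, (if (β.box p).1 = y - 1 then (1 : 𝕜) else 0) = x - 1 := by
    rw [Finset.sum_boole, h.card_row, hx]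
  have h4 : ∑ p, (if (β.box p).2 = x - 1 then (1 : 𝕜) else 0) = y - 1 := by
    rw [Finset.sum_boole, h.card_col, hy]
  simp only [content, Fin.sum_univ_castSucc, Fin.snoc_castSucc, Fin.snoc_last, h1, h2,
    Fin.castSucc_inj, if_false, if_true, eq_comm (a := y - 1), eq_comm (a := x - 1),
    add_zero]
  simp only [Finset.sum_add_distrib, Finset.sum_sub_distrib, h3, h4]
  ring

theorem Diagram.isPrimitiveElement_symmetrizer [CharZero 𝕜] {m : ℕ} (γ : Diagram m) :
    IsPrimitiveElement (γ.symmetrizer 𝕜) :=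
  isPrimitiveElement_rowSum_mul_colSum γ.isTableau_box

theorem Diagram.swapSum_mul_symmetrizer [CharZero 𝕜] {m : ℕ} (γ : Diagram m) :
    swapSum 𝕜 m * γ.symmetrizer 𝕜 = content 𝕜 γ.box • γ.symmetrizer 𝕜 :=
  swapSum_mul_rowSum_mul_colSum γ.isTableau_box

theorem RemovesBox.exists_mul_ne_zero [CharZero 𝕜] (h : RemovesBox α β x y) :
    ∃ r, algMap (permSucc n) (β.symmetrizer 𝕜) * r * α.symmetrizer 𝕜 ≠ 0 :=
  exists_algMap_mul_ne_zero β.isTableau_box α.isTableau_box h.isTableau_snoc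

/-- The row-by-row numbering of `α` need not extend that of `β`. The symmetrizers of two numberings
of `α` are conjugate, so the central `swapSum` has the same scalar on both. -/
theorem RemovesBox.content_eq [CharZero 𝕜] (h : RemovesBox α β x y) :
    content 𝕜 α.box = content 𝕜 β.box + 2 * ((x : 𝕜) - y) + 1 := by
  rw [← h.content_snoc]
  have hs := swapSum_mul_rowSum_mul_colSum (𝕜 := 𝕜) h.isTableau_snoc
  have ha := α.swapSum_mul_symmetrizer (𝕜 := 𝕜)
  obtain ⟨w, hw⟩ := α.isTableau_box.exists_comp h.isTableau_snoc
  have hcomp := rowSum_mul_colSum_comp (𝕜 := 𝕜) (t := α.box) w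
  rw [← hw] at hcomp
  have hne := (isPrimitiveElement_rowSum_mul_colSum (𝕜 := 𝕜) h.isTableau_snoc).ne_zero
  have h1 : swapSum 𝕜 (n + 1) *
      (rowSum (Fin.snoc (α := fun _ => ℕ × ℕ) β.box (y - 1, x - 1)) 𝕜 *
        colSum (Fin.snoc (α := fun _ => ℕ × ℕ) β.box (y - 1, x - 1)) 𝕜) = content 𝕜 α.box •
      (rowSum (Fin.snoc (α := fun _ => ℕ × ℕ) β.box (y - 1, x - 1)) 𝕜 *
        colSum (Fin.snoc (α := fun _ => ℕ × ℕ) β.box (y - 1, x - 1)) 𝕜) := by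
    have ha' : swapSum 𝕜 (n + 1) * (rowSum α.box 𝕜 * colSum α.box 𝕜) =
      content 𝕜 α.box • (rowSum α.box 𝕜 * colSum α.box 𝕜) := ha
    rw [hcomp, ← mul_assoc, ← mul_assoc, ← mul_swapSum, mul_assoc _ (swapSum 𝕜 (n + 1)), ha']
    simp only [mul_smul_comm, smul_mul_assoc]
  rw [h1] at hs
  exact smul_left_injective _ hne hs

end

/-! ### Representations attached to diagrams, and branching -/

section Representations

variable {𝕜 G H V V' : Type*} [Field 𝕜] [Group G] [Group H] [AddCommGroup V] [Module 𝕜 V]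
  [AddCommGroup V'] [Module 𝕜 V']

theorem asAlgebraHom_comp (ρ : Representation 𝕜 G V) (φ : H →* G) (x : 𝕜[H]) :
    Representation.asAlgebraHom (ρ.comp φ) x = ρ.asAlgebraHom (algMap φ x) := by
  induction x using MonoidAlgebra.induction_linear with
  | zero => simp
  | add x y hx hy => simp only [map_add, hx, hy]
  | single g a =>
    rw [algMap_single, Representation.asAlgebraHom_single, Representation.asAlgebraHom_single]
    rfl

theorem coe_asAlgebraHom_toRepresentation {ρ : Representation 𝕜 G V} (W : Subrepresentation ρ)
    (x : 𝕜[G]) (w : W.toSubmodule) :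
    ((W.toRepresentation.asAlgebraHom x w : W.toSubmodule) : V) = ρ.asAlgebraHom x w := by
  induction x using MonoidAlgebra.induction_linear with
  | zero => simp
  | add x y hx hy => simp only [map_add, LinearMap.add_apply, Submodule.coe_add, hx, hy]
  | single g a =>
    rw [Representation.asAlgebraHom_single, Representation.asAlgebraHom_single]
    rfl

theorem asAlgebraHom_mem {ρ : Representation 𝕜 G V} (W : Subrepresentation ρ)
    (x : 𝕜[G]) {w : V} (hw : w ∈ W.toSubmodule) : ρ.asAlgebraHom x w ∈ W.toSubmodule := by
  rw [← coe_asAlgebraHom_toRepresentation W x ⟨w, hw⟩]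
  exact Subtype.prop _

theorem equiv_asAlgebraHom {ρ : Representation 𝕜 G V} {ρ' : Representation 𝕜 G V'}
    (e : ρ.Equiv ρ') (x : 𝕜[G]) (v : V) : e (ρ.asAlgebraHom x v) = ρ'.asAlgebraHom x (e v) := by
  induction x using MonoidAlgebra.induction_linear with
  | zero => simp
  | add x y hx hy => simp only [map_add, LinearMap.add_apply, hx, hy]
  | single g a =>
    rw [Representation.asAlgebraHom_single, Representation.asAlgebraHom_single,
      LinearMap.smul_apply, LinearMap.smul_apply, map_smul]
    congr 1
    exact Representation.IntertwiningMap.isIntertwining _ _ e.toIntertwiningMap g v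

theorem asAlgebraHom_leftRegular (x y : 𝕜[G]) :
    (Representation.leftRegular 𝕜 G).asAlgebraHom x y = x * y :=
  Representation.asAlgebraHom_ofMulAction_smul_eq_mul x y

theorem isIrreducible_of_forall_exists {ρ : Representation 𝕜 G V} [Nontrivial V]
    (h : ∀ v w : V, v ≠ 0 → ∃ x, ρ.asAlgebraHom x v = w) : ρ.IsIrreducible where
  exists_pair_ne := by
    refine ⟨⊥, ⊤, fun h => ?_⟩
    have h1 : (⊥ : Submodule 𝕜 V) = ⊤ := congrArg Subrepresentation.toSubmodule h
    exact bot_ne_top h1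
  eq_bot_or_eq_top W := by
    by_cases hW : ∃ v ∈ W.toSubmodule, v ≠ 0
    · right
      obtain ⟨v, hv, hv0⟩ := hW
      apply Subrepresentation.toSubmodule_injective
      refine eq_top_iff.mpr fun w _ => ?_
      obtain ⟨x, rfl⟩ := h v w hv0
      exact asAlgebraHom_mem W x hv
    · left
      push Not at hW
      apply Subrepresentation.toSubmodule_injective
      exact (Submodule.eq_bot_iff _).mpr hW

theorem coe_asAlgebraHom_rep {n : ℕ} (α : Diagram n) (x : 𝕜[Perm (Fin n)])
    (u : (α.leftIdeal 𝕜).toSubmodule) :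
    (((α.rep 𝕜).asAlgebraHom x u : (α.leftIdeal 𝕜).toSubmodule) : 𝕜[Perm (Fin n)]) = x * u := by
  rw [Diagram.rep, coe_asAlgebraHom_toRepresentation, asAlgebraHom_leftRegular]

theorem mem_leftIdeal {n : ℕ} {α : Diagram n} {u : 𝕜[Perm (Fin n)]} :
    u ∈ (α.leftIdeal 𝕜).toSubmodule ↔ ∃ x, u = x * α.symmetrizer 𝕜 := by
  constructor
  · rintro ⟨x, rfl⟩
    exact ⟨x, rfl⟩
  · rintro ⟨x, rfl⟩
    exact ⟨x, rfl⟩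

variable [CharZero 𝕜] {n : ℕ}

theorem Diagram.rep_isIrreducible (α : Diagram n) : (α.rep 𝕜).IsIrreducible := by
  have hc := α.isPrimitiveElement_symmetrizer (𝕜 := 𝕜)
  have : Nontrivial (α.leftIdeal 𝕜).toSubmodule :=
    ⟨⟨α.symmetrizer 𝕜, mem_leftIdeal.mpr ⟨1, (one_mul _).symm⟩⟩, 0,
      fun h => hc.ne_zero (congrArg Subtype.val h)⟩
  apply isIrreducible_of_forall_exists
  rintro ⟨v, hv⟩ ⟨w, hw⟩ hv0
  obtain ⟨y, s, hy⟩ := hc.exists_mul_eq (u := v) (fun h => hv0 (Subtype.ext h))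
    (mem_leftIdeal.mp hv)
  obtain ⟨x, rfl⟩ := mem_leftIdeal.mp hw
  refine ⟨x * (s • (α.symmetrizer 𝕜 * y)), Subtype.ext ?_⟩
  rw [coe_asAlgebraHom_rep, mul_assoc, hy]

/-- The map from the left ideal of `α` to a representation determined by a vector. -/
noncomputable def orbitMap (α : Diagram n) (ρ : Representation 𝕜 (Perm (Fin n)) V) (u : V) :
    (α.rep 𝕜).IntertwiningMap ρ where
  toLinearMap := (LinearMap.applyₗ u ∘ₗ ρ.asAlgebraHom.toLinearMap) ∘ₗ
    (α.leftIdeal 𝕜).toSubmodule.subtype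
  isIntertwining' g := by
    ext v
    have h := coe_asAlgebraHom_rep α (MonoidAlgebra.single g 1) v
    rw [Representation.asAlgebraHom_single_one] at h
    simp [h]

/-- Schur's lemma: the orbit map sends the symmetrizer to a nonzero vector, so it is a nonzero map
between irreducibles. -/
theorem nonempty_equiv_of_ne_zero {α : Diagram n} {ρ : Representation 𝕜 (Perm (Fin n)) V}
    (hρ : ρ.IsIrreducible) {u : V} (hu : ρ.asAlgebraHom (α.symmetrizer 𝕜) u ≠ 0) :
    Nonempty (ρ.Equiv (α.rep 𝕜)) := by
  have := α.rep_isIrreducible (𝕜 := 𝕜)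
  rcases Representation.IsIrreducible.bijective_or_eq_zero (orbitMap α ρ u) with h | h
  · exact ⟨((orbitMap α ρ u).ofBijective h).symm⟩
  · exfalso
    apply hu
    have h1 := congrArg (fun f => f ⟨α.symmetrizer 𝕜, mem_leftIdeal.mpr ⟨1, (one_mul _).symm⟩⟩) h
    exact h1

theorem exists_ne_zero_of_equiv {α : Diagram n} {ρ : Representation 𝕜 (Perm (Fin n)) V}
    (e : ρ.Equiv (α.rep 𝕜)) : ∃ u, ρ.asAlgebraHom (α.symmetrizer 𝕜) u ≠ 0 := by
  have hc := α.isPrimitiveElement_symmetrizer (𝕜 := 𝕜)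
  obtain ⟨κ, hκ, hcc⟩ := hc.exists_mul_self
  refine ⟨e.symm ⟨α.symmetrizer 𝕜, mem_leftIdeal.mpr ⟨1, (one_mul _).symm⟩⟩, fun h => ?_⟩
  have h1 := congrArg e h
  rw [equiv_asAlgebraHom, Representation.Equiv.apply_symm_apply, map_zero] at h1
  have h2 := congrArg Subtype.val h1
  rw [coe_asAlgebraHom_rep, hcc] at h2
  exact smul_ne_zero hκ hc.ne_zero h2

theorem asAlgebraHom_swapSum_of_equiv {α : Diagram n} {ρ : Representation 𝕜 (Perm (Fin n)) V}
    (e : ρ.Equiv (α.rep 𝕜)) (v : V) :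
    ρ.asAlgebraHom (swapSum 𝕜 n) v = content 𝕜 α.box • v := by
  apply e.toLinearEquiv.injective
  change e _ = e _
  rw [equiv_asAlgebraHom, map_smul]
  apply Subtype.ext
  rw [coe_asAlgebraHom_rep, Submodule.coe_smul]
  obtain ⟨x, hx⟩ := mem_leftIdeal.mp (e v).2
  rw [hx, ← mul_assoc, ← mul_swapSum, mul_assoc, α.swapSum_mul_symmetrizer, mul_smul_comm]

/-- The branching rule: in a decomposition of the restriction of `[α]` into irreducible
representations, exactly one summand is isomorphic to `[β]` when `β` is obtained from `α` by
removing a box. -/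
theorem RemovesBox.existsUnique_equiv {α : Diagram (n + 1)} {β : Diagram n} {x y : ℕ}
    (h : RemovesBox α β x y) {ρ : Representation 𝕜 (Perm (Fin (n + 1))) V}
    {τ : Representation 𝕜 (Perm (Fin n)) V} (hτ : τ = ρ.comp (permSucc n))
    {W : Subrepresentation ρ} (e : W.toRepresentation.Equiv (α.rep 𝕜))
    {m : ℕ} {X : Fin m → Subrepresentation τ}
    (irreducible : ∀ j, (X j).toRepresentation.IsIrreducible)
    (independent : iSupIndep fun j => (X j).toSubmodule)
    (sum_eq : ⨆ j, (X j).toSubmodule = W.toSubmodule) :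
    ∃! j, Nonempty ((X j).toRepresentation.Equiv (β.rep 𝕜)) := by
  have hE : ∀ v, τ.asAlgebraHom (β.symmetrizer 𝕜) v =
      ρ.asAlgebraHom (algMap (permSucc n) (β.symmetrizer 𝕜)) v := by
    intro v; rw [hτ, asAlgebraHom_comp]
  have he : ∀ w : W.toSubmodule,
      ((e (W.toRepresentation.asAlgebraHom (algMap (permSucc n) (β.symmetrizer 𝕜)) w) :
        (α.leftIdeal 𝕜).toSubmodule) : 𝕜[Perm (Fin (n + 1))]) =
        algMap (permSucc n) (β.symmetrizer 𝕜) * (e w : (α.leftIdeal 𝕜).toSubmodule) := by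
    intro w; rw [equiv_asAlgebraHom, coe_asAlgebraHom_rep]
  have hW0 : ∀ w : W.toSubmodule, algMap (permSucc n) (β.symmetrizer 𝕜) *
      ((e w : (α.leftIdeal 𝕜).toSubmodule) : 𝕜[Perm (Fin (n + 1))]) = 0 ↔
      τ.asAlgebraHom (β.symmetrizer 𝕜) w = 0 := by
    intro w
    rw [← he, hE, ← coe_asAlgebraHom_toRepresentation, ZeroMemClass.coe_eq_zero,
      ZeroMemClass.coe_eq_zero]
    exact map_eq_zero_iff e e.toLinearEquiv.injective
  have hX : ∀ j, ∀ v ∈ (X j).toSubmodule, v ∈ W.toSubmodule := fun j v hv =>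
    sum_eq ▸ Submodule.mem_iSup_of_mem j hv
  -- If the symmetrizer of `β` killed every summand it would kill `W`, hence the left ideal of `α`.
  have hex : ∃ j, ∃ u ∈ (X j).toSubmodule, τ.asAlgebraHom (β.symmetrizer 𝕜) u ≠ 0 := by
    by_contra! hno
    have hle : W.toSubmodule ≤ LinearMap.ker (τ.asAlgebraHom (β.symmetrizer 𝕜)) := by
      rw [← sum_eq]
      exact iSup_le fun j u hu => hno j u hu
    obtain ⟨r, hr⟩ := h.exists_mul_ne_zero (𝕜 := 𝕜)
    let u : (α.leftIdeal 𝕜).toSubmodule := ⟨r * α.symmetrizer 𝕜, mem_leftIdeal.mpr ⟨r, rfl⟩⟩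
    have h1 := (hW0 (e.symm u)).mpr (hle (e.symm u).2)
    rw [Representation.Equiv.apply_symm_apply] at h1
    exact hr (by rw [mul_assoc]; exact h1)
  obtain ⟨j, u, hu, huE⟩ := hex
  refine ⟨j, nonempty_equiv_of_ne_zero (irreducible j) (u := ⟨u, hu⟩) fun h0 => huE ?_, ?_⟩
  · have := congrArg Subtype.val h0
    rwa [coe_asAlgebraHom_toRepresentation] at this
  · rintro j' ⟨e'⟩
    by_contra hj
    obtain ⟨⟨u', hu'⟩, huE'⟩ := exists_ne_zero_of_equiv e'
    have huE'' : τ.asAlgebraHom (β.symmetrizer 𝕜) u' ≠ 0 := by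
      intro h0
      apply huE'
      apply Subtype.ext
      rw [coe_asAlgebraHom_toRepresentation]
      exact h0
    obtain ⟨a, ha⟩ := mem_leftIdeal.mp (e ⟨u, hX j u hu⟩).2
    obtain ⟨b, hb⟩ := mem_leftIdeal.mp (e ⟨u', hX j' u' hu'⟩).2
    -- Multiplicity one makes the images of `u` and `u'` under the symmetrizer proportional, yet
    -- they lie in independent summands and the image of `u'` is nonzero.
    obtain ⟨s, hs⟩ := (β.isPrimitiveElement_symmetrizer (𝕜 := 𝕜)).exists_smul_eq
      (α.isPrimitiveElement_symmetrizer (𝕜 := 𝕜)) (conjInverse_viaEmbeddingHom n)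
      (u := algMap (permSucc n) (β.symmetrizer 𝕜) *
        (e ⟨u, hX j u hu⟩ : (α.leftIdeal 𝕜).toSubmodule))
      (v := algMap (permSucc n) (β.symmetrizer 𝕜) *
        (e ⟨u', hX j' u' hu'⟩ : (α.leftIdeal 𝕜).toSubmodule))
      (fun h0 => huE ((hW0 _).mp h0)) ⟨a, by rw [ha, mul_assoc]⟩ ⟨b, by rw [hb, mul_assoc]⟩
    have h2 : τ.asAlgebraHom (β.symmetrizer 𝕜) (u' - s • u) = 0 := by
      have := (hW0 (⟨u', hX j' u' hu'⟩ - s • ⟨u, hX j u hu⟩)).mp (by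
        rw [map_sub, map_smul, Submodule.coe_sub, Submodule.coe_smul, mul_sub, mul_smul_comm, hs,
          sub_self])
      exact this
    rw [map_sub, map_smul, sub_eq_zero] at h2
    have hdis := independent.pairwiseDisjoint hj
    have h3 : τ.asAlgebraHom (β.symmetrizer 𝕜) u' ∈ (X j).toSubmodule := by
      rw [h2]
      exact (X j).toSubmodule.smul_mem s (asAlgebraHom_mem (X j) _ hu)
    exact huE'' (Submodule.disjoint_def.mp hdis _ (asAlgebraHom_mem (X j') _ hu') h3)

end Representations

/-! ### Central elements act by scalars -/

/-- Transpositions are their own inverses, so left multiplication by `swapSum` is Hermitian in the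
group basis; its characteristic polynomial splits, over ℝ as well. -/
theorem exists_splits_aeval_swapSum (𝕜 : Type*) [RCLike 𝕜] (n : ℕ) :
    ∃ p : Polynomial 𝕜, p ≠ 0 ∧ p.Splits ∧ Polynomial.aeval (swapSum 𝕜 n) p = 0 := by
  classical
  let M := Algebra.leftMulMatrix (groupBasis 𝕜 (Perm (Fin n))) (swapSum 𝕜 n)
  have hM : M.IsHermitian := by
    ext g h
    rw [Matrix.conjTranspose_apply]
    simp only [M, Algebra.leftMulMatrix_eq_repr_mul, groupBasis_apply, groupBasis_repr,
      MonoidAlgebra.coeff_mul_single_apply, swapSum, MonoidAlgebra.coeff_sum, Finset.sum_apply',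
      MonoidAlgebra.coeff_single, Finsupp.single_apply, mul_one, star_sum]
    refine Finset.sum_congr rfl fun p _ => Finset.sum_congr rfl fun q _ => ?_
    have : swap p q = h * g⁻¹ ↔ swap p q = g * h⁻¹ := by
      rw [← inv_inj, swap_inv, mul_inv_rev, inv_inv]
    simp [this, apply_ite]
  refine ⟨M.charpoly, M.charpoly_monic.ne_zero, hM.splits_charpoly, ?_⟩
  apply Algebra.leftMulMatrix_injective (groupBasis 𝕜 (Perm (Fin n)))
  rw [map_zero, ← Polynomial.aeval_algHom_apply]
  exact Matrix.aeval_self_charpoly M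

theorem exists_asAlgebraHom_swapSum_eq_smul {𝕜 V : Type*} [RCLike 𝕜] [AddCommGroup V] [Module 𝕜 V]
    [FiniteDimensional 𝕜 V] {n : ℕ} {ρ : Representation 𝕜 (Perm (Fin n)) V}
    (hρ : ρ.IsIrreducible) : ∃ s : 𝕜, ∀ v, ρ.asAlgebraHom (swapSum 𝕜 n) v = s • v := by
  obtain ⟨p, hp0, hp, hpS⟩ := exists_splits_aeval_swapSum 𝕜 n
  have hV : Nontrivial V := by
    by_contra hV
    rw [not_nontrivial_iff_subsingleton] at hV
    apply bot_ne_top (α := Subrepresentation ρ)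
    apply Subrepresentation.toSubmodule_injective
    exact Subsingleton.elim _ _
  set f := ρ.asAlgebraHom (swapSum 𝕜 n) with hf
  have hpf : Polynomial.aeval f p = 0 := by
    rw [hf, Polynomial.aeval_algHom_apply, hpS, map_zero]
  have hdvd := minpoly.dvd 𝕜 f hpf
  have hs := hp.of_dvd hp0 hdvd
  obtain ⟨s, hs⟩ := hs.exists_eval_eq_zero
    (minpoly.degree_pos (Algebra.IsIntegral.isIntegral f)).ne'
  have hev : Module.End.HasEigenvalue f s := Module.End.hasEigenvalue_of_isRoot hs
  -- The eigenspace is invariant because `swapSum` is central, and nonzero because `s` is a root of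
  -- the minimal polynomial.
  let W : Subrepresentation ρ := ⟨Module.End.eigenspace f s, by
    intro g v hv
    rw [Module.End.mem_eigenspace_iff] at hv ⊢
    have := congrArg (fun x => ρ.asAlgebraHom x v) (single_mul_swapSum (𝕜 := 𝕜) g)
    simp only [map_mul, Representation.asAlgebraHom_single_one, Module.End.mul_apply, ← hf] at this
    rw [← this, hv, map_smul]⟩
  have hW : W = ⊤ := by
    refine (hρ.eq_bot_or_eq_top W).resolve_left fun h => hev ?_
    exact congrArg Subrepresentation.toSubmodule h
  refine ⟨s, fun v => ?_⟩
  have : v ∈ W.toSubmodule := by rw [hW]; trivial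
  exact Module.End.mem_eigenspace_iff.mp this

/-! ### Decomposition into irreducible representations -/

section Decomposition

variable {𝕜 G V : Type*} [Field 𝕜] [Group G] [AddCommGroup V] [Module 𝕜 V]

theorem isIrreducible_toRepresentation {ρ : Representation 𝕜 G V} {W : Subrepresentation ρ}
    (hW : W.toSubmodule ≠ ⊥)
    (h : ∀ A : Subrepresentation ρ, A.toSubmodule ≤ W.toSubmodule → A.toSubmodule = ⊥ ∨
      A.toSubmodule = W.toSubmodule) : W.toRepresentation.IsIrreducible where
  exists_pair_ne := by
    refine ⟨⊥, ⊤, fun h => hW ?_⟩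
    have h1 : (⊥ : Submodule 𝕜 W.toSubmodule) = ⊤ := congrArg Subrepresentation.toSubmodule h
    rw [eq_bot_iff]
    intro w hw
    have h2 : (⟨w, hw⟩ : W.toSubmodule) ∈ (⊥ : Submodule 𝕜 W.toSubmodule) := by rw [h1]; trivial
    simpa using h2
  eq_bot_or_eq_top A := by
    let A' : Subrepresentation ρ := ⟨A.toSubmodule.map W.toSubmodule.subtype, by
      rintro g _ ⟨a, ha, rfl⟩
      exact ⟨_, A.apply_mem_toSubmodule g ha, rfl⟩⟩
    rcases h A' (Submodule.map_subtype_le _ _) with h1 | h1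
    · left
      apply Subrepresentation.toSubmodule_injective
      exact Submodule.map_injective_of_injective W.toSubmodule.injective_subtype
        (h1.trans (Submodule.map_bot _).symm)
    · right
      apply Subrepresentation.toSubmodule_injective
      refine eq_top_iff.mpr fun w _ => ?_
      have h2 : (w : V) ∈ A'.toSubmodule := by rw [h1]; exact w.2
      obtain ⟨a, ha, haw⟩ := h2
      rwa [← Subtype.ext haw]

variable [CharZero 𝕜] [Finite G] [FiniteDimensional 𝕜 V]

/-- Induction on dimension: a Maschke complement of a proper nonzero subrepresentation `A`, cut down
to `W`, is a complement inside `W` by the modular law. -/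
theorem exists_finset_irreducible (ρ : Representation 𝕜 G V) (d : ℕ) :
    ∀ W : Subrepresentation ρ, Module.finrank 𝕜 W.toSubmodule = d →
      ∃ s : Finset (Submodule 𝕜 V), s.SupIndep id ∧ s.sup id = W.toSubmodule ∧
        ∀ A ∈ s, ∃ X : Subrepresentation ρ, X.toSubmodule = A ∧
          X.toRepresentation.IsIrreducible := by
  classical
  induction d using Nat.strong_induction_on with
  | _ d ih =>
    intro W hd
    by_cases hW : W.toSubmodule = ⊥
    · exact ⟨∅, Finset.supIndep_empty _, by simp [hW], by simp⟩
    by_cases h : ∀ A : Subrepresentation ρ, A.toSubmodule ≤ W.toSubmodule → A.toSubmodule = ⊥ ∨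
        A.toSubmodule = W.toSubmodule
    · exact ⟨{W.toSubmodule}, Finset.supIndep_singleton _ _, by simp,
        by simpa using ⟨W, rfl, isIrreducible_toRepresentation hW h⟩⟩
    push Not at h
    obtain ⟨A, hAW, hA0, hA⟩ := h
    have : NeZero (Nat.card G : 𝕜) := ⟨Nat.cast_ne_zero.mpr Nat.card_pos.ne'⟩
    obtain ⟨C, hC⟩ := exists_isCompl A
    have hinf : A.toSubmodule ⊓ C.toSubmodule = ⊥ :=
      congrArg Subrepresentation.toSubmodule hC.inf_eq_bot
    have hsup : A.toSubmodule ⊔ C.toSubmodule = ⊤ :=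
      congrArg Subrepresentation.toSubmodule hC.sup_eq_top
    have hABW : A.toSubmodule ⊔ (C ⊓ W).toSubmodule = W.toSubmodule := by
      rw [Subrepresentation.toSubmodule_inf, ← sup_inf_assoc_of_le _ hAW, hsup, top_inf_eq]
    have hAB : Disjoint A.toSubmodule (C ⊓ W).toSubmodule := by
      rw [disjoint_iff, Subrepresentation.toSubmodule_inf, ← inf_assoc, hinf, bot_inf_eq]
    have hlt : Module.finrank 𝕜 A.toSubmodule < d := by
      rw [← hd]
      exact Submodule.finrank_lt_finrank_of_lt (lt_of_le_of_ne hAW hA)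
    have hlt' : Module.finrank 𝕜 (C ⊓ W).toSubmodule < d := by
      rw [← hd]
      refine Submodule.finrank_lt_finrank_of_lt (lt_of_le_of_ne inf_le_right fun h => hA0 ?_)
      rw [h, disjoint_iff, inf_eq_left.mpr hAW] at hAB
      exact hAB
    obtain ⟨s, hs, hsA, hsI⟩ := ih _ hlt A rfl
    obtain ⟨t, ht, htB, htI⟩ := ih _ hlt' (C ⊓ W) rfl
    refine ⟨s ∪ t, hs.union ht (by rw [hsA, htB]; exact hAB), ?_, ?_⟩
    · rw [Finset.sup_union, hsA, htB, hABW]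
    · intro B hB
      rcases Finset.mem_union.mp hB with hB | hB
      · exact hsI B hB
      · exact htI B hB

theorem exists_irreducible_decomposition {ρ : Representation 𝕜 G V} (W : Subrepresentation ρ) :
    ∃ (m : ℕ) (X : Fin m → Subrepresentation ρ), (∀ j, (X j).toRepresentation.IsIrreducible) ∧
      (iSupIndep fun j => (X j).toSubmodule) ∧ ⨆ j, (X j).toSubmodule = W.toSubmodule := by
  obtain ⟨s, hs, hsup, hI⟩ := exists_finset_irreducible ρ _ W rfl
  choose X hX hXI using hI
  refine ⟨s.card, fun j => X (s.equivFin.symm j) (s.equivFin.symm j).2, fun j => hXI _ _, ?_, ?_⟩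
  · simp only [hX]
    have h := (iSupIndep_comp_coe_iff_supIndep (f := id)).mpr hs
    exact h.comp s.equivFin.symm.injective
  · simp only [hX]
    rw [← hsup, Finset.sup_eq_iSup, s.equivFin.symm.iSup_comp (g := fun A : s => (A : Submodule 𝕜 V)),
      iSup_subtype]
    rfl

end Decomposition

/-! ### Gelfand–Tsetlin bases -/

section GelfandTsetlin

variable {𝕜 V : Type*} [Field 𝕜] [AddCommGroup V] [Module 𝕜 V] {n : ℕ}
  {σ : Representation 𝕜 (Perm (Fin n)) V} {U : V → ℕ → Submodule 𝕜 V} {i : ℕ} {hi : i ≤ n}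
  {W : Subrepresentation (restrictTo σ i hi)} {B : Set V}

theorem viaEmbeddingHom_castLE {i : ℕ} (hi : i + 1 ≤ n) (g : Perm (Fin i)) :
    Perm.viaEmbeddingHom (Fin.castLEEmb hi) (permSucc i g) =
      Perm.viaEmbeddingHom (Fin.castLEEmb (Nat.le_of_succ_le hi)) g := by
  ext1 p
  change Perm.viaEmbedding (permSucc i g) (Fin.castLEEmb hi) p =
    Perm.viaEmbedding g (Fin.castLEEmb (Nat.le_of_succ_le hi)) p
  by_cases hp : (p : ℕ) < i + 1
  · have h1 : p = Fin.castLEEmb hi ⟨p, hp⟩ := rfl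
    rw [h1, Perm.viaEmbedding_apply]
    by_cases hp' : (p : ℕ) < i
    · have h2 : Fin.castLEEmb hi ⟨p, hp⟩ = Fin.castLEEmb (Nat.le_of_succ_le hi) ⟨p, hp'⟩ := rfl
      have h3 : (⟨p, hp⟩ : Fin (i + 1)) = Fin.castSucc ⟨p, hp'⟩ := rfl
      rw [h2, Perm.viaEmbedding_apply, h3, permSucc_castSucc]
      rfl
    · have h3 : (⟨p, hp⟩ : Fin (i + 1)) = Fin.last i := Fin.ext (by simp; omega)
      rw [h3, permSucc_last, Perm.viaEmbedding_apply_of_notMem]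
      rintro ⟨q, hq⟩
      have := congrArg Fin.val hq
      simp at this
      omega
  · rw [Perm.viaEmbedding_apply_of_notMem, Perm.viaEmbedding_apply_of_notMem]
    · rintro ⟨q, hq⟩
      have := congrArg Fin.val hq
      simp at this
      omega
    · rintro ⟨q, hq⟩
      have := congrArg Fin.val hq
      simp at this
      omega

theorem restrictTo_eq_comp (σ : Representation 𝕜 (Perm (Fin n)) V) {i : ℕ} (hi : i + 1 ≤ n) :
    restrictTo σ i (Nat.le_of_succ_le hi) = (restrictTo σ (i + 1) hi).comp (permSucc i) := by
  ext1 g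
  rw [restrictTo, restrictTo, MonoidHom.comp_apply, MonoidHom.comp_apply, MonoidHom.comp_apply,
    viaEmbeddingHom_castLE]

theorem IsGTBasisOf.apply_self (h : IsGTBasisOf σ U i hi W B) {v : V} (hv : v ∈ B) :
    U v i = W.toSubmodule := by
  cases h with
  | base hi W w hw hW hU =>
    rw [Set.mem_singleton_iff.mp hv, hU]
  | step i one_le hi W m X C irreducible independent sum_eq basis hU => exact hU v hv

/-- Only the values of `U` on the basis and at levels up to `i` matter, so the records of different
summands can be glued. -/
theorem IsGTBasisOf.update (h : IsGTBasisOf σ U i hi W B) {U' : V → ℕ → Submodule 𝕜 V}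
    (hU' : ∀ v ∈ B, ∀ j ≤ i, U' v j = U v j) : IsGTBasisOf σ U' i hi W B := by
  induction h with
  | base hi W w hw hW hU =>
    exact .base hi W w hw hW (by rw [hU' w rfl 1 le_rfl, hU])
  | step i one_le hi W m X C irreducible independent sum_eq basis hU ih =>
    refine .step i one_le hi W m X C irreducible independent sum_eq
      (fun j => ih j fun v hv k hk => hU' v (Set.mem_iUnion_of_mem j hv) k (by omega))
      fun v hv => ?_
    rw [hU' v hv _ le_rfl, hU v hv]

theorem IsGTBasisOf.ne_zero_and_mem (h : IsGTBasisOf σ U i hi W B) {v : V} (hv : v ∈ B) :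
    v ≠ 0 ∧ v ∈ W.toSubmodule := by
  induction h with
  | base hi W w hw hW hU =>
    rw [Set.mem_singleton_iff.mp hv, hW]
    exact ⟨hw, Submodule.mem_span_singleton_self w⟩
  | step i one_le hi W m X C irreducible independent sum_eq basis hU ih =>
    obtain ⟨j, hj⟩ := Set.mem_iUnion.mp hv
    refine ⟨(ih j hj).1, ?_⟩
    rw [← sum_eq]
    exact Submodule.mem_iSup_of_mem j (ih j hj).2

theorem IsGTBasisOf.linearIndepOn_and_span (h : IsGTBasisOf σ U i hi W B) :
    LinearIndepOn 𝕜 id B ∧ Submodule.span 𝕜 B = W.toSubmodule := by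
  induction h with
  | base hi W w hw hW hU =>
    exact ⟨LinearIndepOn.singleton hw, hW.symm⟩
  | step i one_le hi W m X C irreducible independent sum_eq basis hU ih =>
    constructor
    · refine linearIndepOn_id_iUnion_finite (fun j => (ih j).1) fun j t _ hj => ?_
      simp only [(ih _).2]
      exact independent.disjoint_biSup hj
    · rw [Submodule.span_iUnion, ← sum_eq]
      simp only [(ih _).2]

theorem IsGTBasisOf.exists_irreducible (h : IsGTBasisOf σ U i hi W B)
    (hW : W.toRepresentation.IsIrreducible) {v : V} (hv : v ∈ B) (k : ℕ) (hk : 1 ≤ k)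
    (hki : k ≤ i) : ∃ W' : Subrepresentation (restrictTo σ k (hki.trans hi)),
      W'.toSubmodule = U v k ∧ v ∈ W'.toSubmodule ∧ W'.toRepresentation.IsIrreducible := by
  rcases hki.eq_or_lt with rfl | hlt
  · exact ⟨W, (h.apply_self hv).symm, (h.ne_zero_and_mem hv).2, hW⟩
  induction h with
  | base hi W w hw hW hU => omega
  | step i one_le hi W m X C irreducible independent sum_eq basis hU ih =>
    obtain ⟨j, hj⟩ := Set.mem_iUnion.mp hv
    rcases (Nat.le_of_lt_succ hlt).eq_or_lt with rfl | hlt'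
    · exact ⟨X j, ((basis j).apply_self hj).symm, ((basis j).ne_zero_and_mem hj).2, irreducible j⟩
    · exact ih j (irreducible j) hj hlt'.le hlt'

theorem IsGTBasisOf.mem_apply (h : IsGTBasisOf σ U i hi W B) {v : V} (hv : v ∈ B) (k : ℕ)
    (hk : 1 ≤ k) (hki : k ≤ i) : v ∈ U v k := by
  rcases hki.eq_or_lt with rfl | hlt
  · exact h.apply_self hv ▸ (h.ne_zero_and_mem hv).2
  induction h with
  | base hi W w hw hW hU => omega
  | step i one_le hi W m X C irreducible independent sum_eq basis hU ih =>
    obtain ⟨j, hj⟩ := Set.mem_iUnion.mp hv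
    rcases (Nat.le_of_lt_succ hlt).eq_or_lt with rfl | hlt'
    · exact (basis j).apply_self hj ▸ ((basis j).ne_zero_and_mem hj).2
    · exact ih j hj hlt'.le hlt'

theorem exists_isGTBasisOf [CharZero 𝕜] [FiniteDimensional 𝕜 V]
    (σ : Representation 𝕜 (Perm (Fin n)) V) {i : ℕ} (hi1 : 1 ≤ i) :
    ∀ (hi : i ≤ n) (W : Subrepresentation (restrictTo σ i hi)),
      W.toRepresentation.IsIrreducible → ∃ U B, IsGTBasisOf σ U i hi W B := by
  classical
  induction i, hi1 using Nat.le_induction with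
  | base =>
    intro hi W hW
    have hW0 : W.toSubmodule ≠ ⊥ := by
      intro h
      have : Subsingleton W.toSubmodule := by rw [h]; infer_instance
      exact bot_ne_top (Subrepresentation.toSubmodule_injective
        (Subsingleton.elim (⊥ : Subrepresentation W.toRepresentation).toSubmodule
          (⊤ : Subrepresentation W.toRepresentation).toSubmodule))
    obtain ⟨w, hw, hw0⟩ := Submodule.exists_mem_ne_zero_of_ne_bot hW0
    -- S_1 is trivial, so every line is invariant and an irreducible representation is a line.
    let A : Subrepresentation W.toRepresentation := ⟨Submodule.span 𝕜 {⟨w, hw⟩}, by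
      intro g v hv
      rw [Subsingleton.elim g 1, map_one]
      exact hv⟩
    have hA : A = ⊤ := by
      refine (hW.eq_bot_or_eq_top A).resolve_left fun h => hw0 ?_
      have h1 : Submodule.span 𝕜 {(⟨w, hw⟩ : W.toSubmodule)} = ⊥ :=
        congrArg Subrepresentation.toSubmodule h
      rw [Submodule.span_singleton_eq_bot] at h1
      exact congrArg Subtype.val h1
    refine ⟨fun _ _ => W.toSubmodule, {w}, .base hi W w hw0 ?_ rfl⟩
    apply le_antisymm
    · intro v hv
      have h1 : (⟨v, hv⟩ : W.toSubmodule) ∈ A.toSubmodule := by rw [hA]; trivial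
      obtain ⟨a, ha⟩ := Submodule.mem_span_singleton.mp h1
      exact Submodule.mem_span_singleton.mpr ⟨a, congrArg Subtype.val ha⟩
    · rw [Submodule.span_singleton_le_iff_mem]
      exact hw
  | succ i hi1 ih =>
    intro hi W hW
    let W' : Subrepresentation (restrictTo σ i (Nat.le_of_succ_le hi)) := ⟨W.toSubmodule, by
      intro g v hv
      rw [DFunLike.congr_fun (restrictTo_eq_comp σ hi) g]
      exact W.apply_mem_toSubmodule _ hv⟩
    obtain ⟨m, X, hX, hXi, hXs⟩ := exists_irreducible_decomposition W'
    choose U C hUC using fun j => ih (Nat.le_of_succ_le hi) (X j) (hX j)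
    have hdisj : ∀ j j' v, v ∈ C j → v ∈ C j' → j = j' := by
      intro j j' v hj hj'
      by_contra hne
      exact ((hUC j).ne_zero_and_mem hj).1 (Submodule.disjoint_def.mp (hXi.pairwiseDisjoint hne) v
        ((hUC j).ne_zero_and_mem hj).2 ((hUC j').ne_zero_and_mem hj').2)
    -- The bases of distinct summands are disjoint, so each basis vector determines its record; the
    -- default ⊥ is only reached off the basis.
    let U' : V → ℕ → Submodule 𝕜 V := fun v k =>
      if k = i + 1 then W.toSubmodule else if h : ∃ j, v ∈ C j then U h.choose v k else ⊥
    refine ⟨U', ⋃ j, C j, .step i hi1 hi W m X C hX hXi hXs (fun j => ?_) fun v _ => if_pos rfl⟩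
    refine (hUC j).update fun v hv k hk => ?_
    have hex : ∃ j, v ∈ C j := ⟨j, hv⟩
    have hj : hex.choose = j := hdisj _ _ v hex.choose_spec hv
    simp only [U']
    rw [if_neg (by omega), dif_pos hex, hj]

theorem IsGTBasisOf.existsUnique [CharZero 𝕜] (h : IsGTBasisOf σ U i hi W B)
    (α : (i : ℕ) → Diagram i) (x y : ℕ → ℕ)
    (hα : ∀ k, 2 ≤ k → k ≤ i → RemovesBox (α k) (α (k - 1)) (x k) (y k))
    (e : Nonempty (W.toRepresentation.Equiv ((α i).rep 𝕜))) :
    ∃! v, v ∈ B ∧ ∀ (k : ℕ) (hk : k ≤ n), 1 ≤ k → k ≤ i →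
      ∃ W' : Subrepresentation (restrictTo σ k hk), W'.toSubmodule = U v k ∧
        Nonempty (W'.toRepresentation.Equiv ((α k).rep 𝕜)) := by
  induction h with
  | base hi W w hw hW hU =>
    refine ⟨w, ⟨rfl, fun k hk hk1 hki => ?_⟩, fun v hv => hv.1⟩
    obtain rfl : k = 1 := by omega
    exact ⟨W, hU.symm, e⟩
  | step i one_le hi W m X C irreducible independent sum_eq basis hU ih =>
    obtain ⟨e⟩ := e
    obtain ⟨j, hj, hjuniq⟩ := (hα (i + 1) (by omega) le_rfl).existsUnique_equiv
      (restrictTo_eq_comp σ hi) e irreducible independent sum_eq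
    obtain ⟨v, ⟨hv, hvα⟩, hvuniq⟩ := ih j (fun k hk hki => hα k hk (by omega)) hj
    refine ⟨v, ⟨Set.mem_iUnion_of_mem j hv, fun k hk hk1 hki => ?_⟩, ?_⟩
    · rcases Nat.le_succ_iff.mp hki with hki' | rfl
      · exact hvα k hk hk1 hki'
      · exact ⟨W, (hU v (Set.mem_iUnion_of_mem j hv)).symm, ⟨e⟩⟩
    · rintro v' ⟨hv', hvα'⟩
      obtain ⟨j', hj'⟩ := Set.mem_iUnion.mp hv'
      -- The level-`i` condition identifies the summand containing `v'` as the unique one isomorphic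
      -- to [α_i].
      obtain ⟨W', hW', e'⟩ := hvα' i (Nat.le_of_succ_le hi) one_le (Nat.le_succ i)
      rw [(basis j').apply_self hj'] at hW'
      obtain rfl := Subrepresentation.toSubmodule_injective hW'
      obtain rfl := hjuniq j' e'
      exact hvuniq v' ⟨hj', fun k hk hk1 hki => hvα' k hk hk1 (by omega)⟩

end GelfandTsetlin

/-! ### The Laplacian of a star -/

section Laplacian

variable {𝕜 : Type*} [Field 𝕜] {n m : ℕ}

theorem viaEmbeddingHom_swap {i : ℕ} (hi : i ≤ n) (p q : Fin i) :
    Perm.viaEmbeddingHom (Fin.castLEEmb hi) (swap p q) =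
      swap (Fin.castLE hi p) (Fin.castLE hi q) := by
  ext1 r
  rw [Perm.viaEmbeddingHom_apply]
  by_cases hr : r ∈ Set.range (Fin.castLEEmb hi)
  · obtain ⟨s, rfl⟩ := hr
    rw [Perm.viaEmbedding_apply]
    exact (Function.Injective.swap_apply (Fin.castLEEmb hi).injective p q s).symm
  · rw [Perm.viaEmbedding_apply_of_notMem _ _ _ hr, swap_apply_of_ne_of_ne]
    · rintro rfl
      exact hr ⟨p, rfl⟩
    · rintro rfl
      exact hr ⟨q, rfl⟩

theorem algMap_swapSum {i : ℕ} (hi : i ≤ n) :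
    algMap (Perm.viaEmbeddingHom (Fin.castLEEmb hi)) (swapSum 𝕜 i) =
      ∑ p, ∑ q, MonoidAlgebra.single (swap (Fin.castLE hi p) (Fin.castLE hi q)) 1 := by
  simp only [swapSum, map_sum, algMap_single, viaEmbeddingHom_swap]

theorem algMap_swapSum_succ (hm : m + 1 ≤ n) :
    algMap (Perm.viaEmbeddingHom (Fin.castLEEmb hm)) (swapSum 𝕜 (m + 1)) =
      algMap (Perm.viaEmbeddingHom (Fin.castLEEmb (Nat.le_of_succ_le hm))) (swapSum 𝕜 m) +
        (2 : 𝕜) • (∑ p : Fin m, MonoidAlgebra.single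
          (swap (Fin.castLE (Nat.le_of_succ_le hm) p) ⟨m, hm⟩) 1) + 1 := by
  rw [algMap_swapSum, algMap_swapSum, Fin.sum_univ_castSucc]
  simp only [Fin.sum_univ_castSucc, Finset.sum_add_distrib]
  have h1 : ∀ p : Fin m, Fin.castLE hm p.castSucc = Fin.castLE (Nat.le_of_succ_le hm) p :=
    fun _ => rfl
  have h2 : Fin.castLE hm (Fin.last m) = ⟨m, hm⟩ := rfl
  have h4 : ∀ p : Fin m, swap (⟨m, hm⟩ : Fin n) (Fin.castLE (Nat.le_of_succ_le hm) p) =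
      swap (Fin.castLE (Nat.le_of_succ_le hm) p) ⟨m, hm⟩ := fun p => swap_comm _ _
  simp only [h1, h2, h4, swap_self, two_smul]
  have h3 : (MonoidAlgebra.single (Equiv.refl (Fin n)) 1 : 𝕜[Perm (Fin n)]) = 1 := rfl
  rw [h3]
  abel

/-- The cliques on m + 1 and m vertices differ only in edges at the vertex of index m, which is k
counted from 1. -/
theorem starMatrix_apply_of_lt {i j : Fin n} (hij : i < j) :
    starMatrix 𝕜 n (m + 1) i j = if (j : ℕ) = m then 1 else 0 := by
  have h : (i : ℕ) < j := hij
  rw [starMatrix, Matrix.sub_apply, SimpleGraph.adjMatrix_apply, SimpleGraph.adjMatrix_apply]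
  simp only [quasiComplete, Nat.add_sub_cancel, ne_eq, hij.ne, not_false_eq_true, true_and]
  by_cases hj : (j : ℕ) = m
  · rw [if_pos (by omega), if_neg (by omega), if_pos hj, sub_zero]
  · rw [if_neg hj]
    by_cases hj' : (j : ℕ) < m
    · rw [if_pos (by omega), if_pos (by omega), sub_self]
    · rw [if_neg (by omega), if_neg (by omega), sub_self]

theorem laplacian_starMatrix (hm : m + 1 ≤ n) :
    laplacian (starMatrix 𝕜 n (m + 1)) = (m : 𝕜) • 1 - ∑ p : Fin m, MonoidAlgebra.single
      (swap (Fin.castLE (Nat.le_of_succ_le hm) p) ⟨m, hm⟩) 1 := by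
  have h1 : ∀ i : Fin n, ∑ j : Fin n with i < j, starMatrix 𝕜 n (m + 1) i j •
      (MonoidAlgebra.single 1 1 - MonoidAlgebra.single (swap i j) 1 : 𝕜[Perm (Fin n)]) =
      if (i : ℕ) < m then 1 - MonoidAlgebra.single (swap i ⟨m, hm⟩) 1 else 0 := by
    intro i
    have h2 : ∀ j ∈ Finset.univ.filter fun j => i < j, starMatrix 𝕜 n (m + 1) i j •
        (MonoidAlgebra.single 1 1 - MonoidAlgebra.single (swap i j) 1 : 𝕜[Perm (Fin n)]) =
        if j = ⟨m, hm⟩ then 1 - MonoidAlgebra.single (swap i ⟨m, hm⟩) 1 else 0 := by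
      intro j hj
      rw [starMatrix_apply_of_lt (by simpa using hj)]
      by_cases h : j = ⟨m, hm⟩
      · subst h
        simp [MonoidAlgebra.one_def]
      · have : (j : ℕ) ≠ m := fun h' => h (Fin.ext h')
        simp [h, this]
    rw [Finset.sum_congr rfl h2, Finset.sum_ite_eq']
    refine if_congr ?_ rfl rfl
    rw [Finset.mem_filter]
    exact and_iff_right (Finset.mem_univ _)
  rw [laplacian, Finset.sum_congr rfl fun i _ => h1 i, ← Finset.sum_filter]
  have h3 : (Finset.univ.filter fun i : Fin n => (i : ℕ) < m) =
      Finset.univ.map (Fin.castLEEmb (Nat.le_of_succ_le hm)) := by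
    ext i
    simp only [Finset.mem_filter, Finset.mem_univ, true_and, Finset.mem_map]
    exact ⟨fun h => ⟨⟨i, h⟩, rfl⟩, by rintro ⟨p, rfl⟩; exact p.2⟩
  rw [h3, Finset.sum_map, Finset.sum_sub_distrib]
  congr 1
  simp [Nat.cast_smul_eq_nsmul]

theorem two_smul_laplacian_starMatrix (hm : m + 1 ≤ n) :
    (2 : 𝕜) • laplacian (starMatrix 𝕜 n (m + 1)) = (2 * m + 1 : 𝕜) • (1 : 𝕜[Perm (Fin n)]) -
      (algMap (Perm.viaEmbeddingHom (Fin.castLEEmb hm)) (swapSum 𝕜 (m + 1)) -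
        algMap (Perm.viaEmbeddingHom (Fin.castLEEmb (Nat.le_of_succ_le hm))) (swapSum 𝕜 m)) := by
  rw [algMap_swapSum_succ, laplacian_starMatrix hm, smul_sub, add_smul, smul_smul, one_smul]
  abel

theorem asAlgebraHom_laplacian [CharZero 𝕜] {V : Type*} [AddCommGroup V] [Module 𝕜 V]
    {σ : Representation 𝕜 (Perm (Fin n)) V} (hm : m + 1 ≤ n) {v : V} {a b : 𝕜}
    (ha : (restrictTo σ (m + 1) hm).asAlgebraHom (swapSum 𝕜 (m + 1)) v = a • v)
    (hb : (restrictTo σ m (Nat.le_of_succ_le hm)).asAlgebraHom (swapSum 𝕜 m) v = b • v) :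
    σ.asAlgebraHom (laplacian (starMatrix 𝕜 n (m + 1))) v = (m - (a - b - 1) / 2 : 𝕜) • v := by
  have h := congrArg (fun x => σ.asAlgebraHom x v) (two_smul_laplacian_starMatrix (𝕜 := 𝕜) hm)
  rw [restrictTo, asAlgebraHom_comp] at ha hb
  simp only [map_smul, map_sub, map_one, LinearMap.smul_apply, LinearMap.sub_apply,
    Module.End.one_apply] at h
  rw [ha, hb, ← sub_smul, ← sub_smul] at h
  have h2 : (2 : 𝕜) ≠ 0 := two_ne_zero
  apply smul_right_injective V h2
  change (2 : 𝕜) • _ = (2 : 𝕜) • _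
  rw [h, smul_smul]
  congr 1
  field_simp
  ring

end Laplacian

/-! ### Identifying σ with its restriction to the whole group, and the conclusion -/

theorem isIrreducible_top {𝕜 G V : Type*} [Field 𝕜] [Group G] [AddCommGroup V] [Module 𝕜 V]
    {ρ τ : Representation 𝕜 G V} (hρ : ρ.IsIrreducible) (hτ : τ = ρ) :
    (⊤ : Subrepresentation τ).toRepresentation.IsIrreducible := by
  subst hτ
  apply isIrreducible_toRepresentation
  · intro h
    exact bot_ne_top (α := Subrepresentation τ) (Subrepresentation.toSubmodule_injective h.symm)
  · intro A _
    rcases hρ.eq_bot_or_eq_top A with h | h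
    · exact Or.inl (congrArg Subrepresentation.toSubmodule h)
    · exact Or.inr (congrArg Subrepresentation.toSubmodule h)

theorem nonempty_equiv_top {𝕜 G V V' : Type*} [Field 𝕜] [Group G] [AddCommGroup V] [Module 𝕜 V]
    [AddCommGroup V'] [Module 𝕜 V'] {ρ τ : Representation 𝕜 G V} {ρ' : Representation 𝕜 G V'}
    (e : Nonempty (ρ.Equiv ρ')) (hτ : τ = ρ) :
    Nonempty ((⊤ : Subrepresentation τ).toRepresentation.Equiv ρ') := by
  subst hτ
  obtain ⟨e⟩ := e
  let f : (⊤ : Subrepresentation τ).toRepresentation.Equiv τ :=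
    .mk (LinearEquiv.ofTop (⊤ : Submodule 𝕜 V) rfl) fun g => rfl
  exact ⟨f.trans e⟩

theorem restrictTo_self {𝕜 V : Type*} [Field 𝕜] [AddCommGroup V] [Module 𝕜 V] {n : ℕ}
    (σ : Representation 𝕜 (Perm (Fin n)) V) : restrictTo σ n le_rfl = σ := by
  ext1 g
  rw [restrictTo, MonoidHom.comp_apply]
  congr 1
  ext1 p
  rw [Perm.viaEmbeddingHom_apply]
  exact Perm.viaEmbedding_apply g (Fin.castLEEmb le_rfl) p

theorem asAlgebraHom_apply_of_mem {𝕜 G V : Type*} [Field 𝕜] [Group G] [AddCommGroup V]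
    [Module 𝕜 V] {ρ : Representation 𝕜 G V} {W : Subrepresentation ρ} {x : 𝕜[G]} {s : 𝕜}
    (h : ∀ w, W.toRepresentation.asAlgebraHom x w = s • w) {v : V} (hv : v ∈ W.toSubmodule) :
    ρ.asAlgebraHom x v = s • v := by
  have := congrArg Subtype.val (h ⟨v, hv⟩)
  rwa [coe_asAlgebraHom_toRepresentation] at this

end StarGT

theorem mainTheorem2 {𝕜 : Type*} [RCLike 𝕜] {V : Type*} [AddCommGroup V] [Module 𝕜 V]
    [FiniteDimensional 𝕜 V] (n k : ℕ) (hk : 2 ≤ k) (hkn : k ≤ n)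
    (σ : Representation 𝕜 (Equiv.Perm (Fin n)) V) :
    (σ.IsIrreducible →
      (∃ (U : V → ℕ → Submodule 𝕜 V) (B : Set V), StarGT.IsGTBasis σ U B) ∧
      ∀ (U : V → ℕ → Submodule 𝕜 V) (B : Set V), StarGT.IsGTBasis σ U B →
        LinearIndepOn 𝕜 id B ∧ Submodule.span 𝕜 B = ⊤ ∧
        ∀ v ∈ B, ∃ c : 𝕜, Module.End.HasEigenvector
          (σ.asAlgebraHom (StarGT.laplacian (StarGT.starMatrix 𝕜 n k))) c v) ∧
    (∀ (α : (i : ℕ) → StarGT.Diagram i) (x y : ℕ → ℕ),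
      (∀ i, 2 ≤ i → i ≤ n → StarGT.RemovesBox (α i) (α (i - 1)) (x i) (y i)) →
      Nonempty (σ.Equiv ((α n).rep 𝕜)) →
      ∀ (U : V → ℕ → Submodule 𝕜 V) (B : Set V), StarGT.IsGTBasis σ U B →
        (∃! v, v ∈ B ∧ StarGT.Corresponds σ U v α) ∧
        ∀ v ∈ B, StarGT.Corresponds σ U v α → Module.End.HasEigenvector
          (σ.asAlgebraHom (StarGT.laplacian (StarGT.starMatrix 𝕜 n k)))
          (((k : 𝕜) - 1) + (y k : 𝕜) - (x k : 𝕜)) v) := by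
  -- As k ≥ 2, m is at least 1, so both levels m and m + 1 occur in the Gelfand–Tsetlin chain.
  obtain ⟨m, rfl⟩ : ∃ m, k = m + 1 := ⟨k - 1, by omega⟩
  constructor
  · intro hσ
    have htop := StarGT.isIrreducible_top hσ (StarGT.restrictTo_self σ)
    refine ⟨StarGT.exists_isGTBasisOf σ (by omega) le_rfl ⊤ htop, fun U B hB => ?_⟩
    refine ⟨hB.linearIndepOn_and_span.1, hB.linearIndepOn_and_span.2, fun v hv => ?_⟩
    obtain ⟨W, -, hvW, hW⟩ := hB.exists_irreducible htop hv (m + 1) (by omega) hkn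
    obtain ⟨W', -, hvW', hW'⟩ := hB.exists_irreducible htop hv m (by omega) (by omega)
    obtain ⟨a, ha⟩ := StarGT.exists_asAlgebraHom_swapSum_eq_smul hW
    obtain ⟨b, hb⟩ := StarGT.exists_asAlgebraHom_swapSum_eq_smul hW'
    exact ⟨_, Module.End.mem_eigenspace_iff.mpr (StarGT.asAlgebraHom_laplacian hkn
      (StarGT.asAlgebraHom_apply_of_mem ha hvW) (StarGT.asAlgebraHom_apply_of_mem hb hvW')),
      (hB.ne_zero_and_mem hv).1⟩
  · intro α x y hα e U B hB
    constructor
    · obtain ⟨v, ⟨hv, hvα⟩, huniq⟩ := hB.existsUnique α x y hα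
        (StarGT.nonempty_equiv_top e (StarGT.restrictTo_self σ))
      exact ⟨v, ⟨hv, fun i hi hi1 => hvα i hi hi1 hi⟩,
        fun w hw => huniq w ⟨hw.1, fun i hi hi1 _ => hw.2 i hi hi1⟩⟩
    · intro v hv hvα
      obtain ⟨W, hW, ⟨e₁⟩⟩ := hvα (m + 1) hkn (by omega)
      obtain ⟨W', hW', ⟨e₂⟩⟩ := hvα m (by omega) (by omega)
      have hvW : v ∈ W.toSubmodule := hW ▸ hB.mem_apply hv (m + 1) (by omega) hkn
      have hvW' : v ∈ W'.toSubmodule := hW' ▸ hB.mem_apply hv m (by omega) (by omega)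
      refine ⟨Module.End.mem_eigenspace_iff.mpr ?_, (hB.ne_zero_and_mem hv).1⟩
      rw [StarGT.asAlgebraHom_laplacian hkn
        (StarGT.asAlgebraHom_apply_of_mem (StarGT.asAlgebraHom_swapSum_of_equiv e₁) hvW)
        (StarGT.asAlgebraHom_apply_of_mem (StarGT.asAlgebraHom_swapSum_of_equiv e₂) hvW')]
      have h : StarGT.RemovesBox (α (m + 1)) (α m) (x (m + 1)) (y (m + 1)) := hα (m + 1) hk hkn
      -- The scalars at levels m + 1 and m differ by 2(x - y) + 1, so the eigenvalue m - (a - b -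
      -- 1)/2 becomes m + y - x.
      rw [h.content_eq]
      congr 1
      push_cast
      ring
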